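/- **Setting.** Let $F$ be a field of characteristic $0$ (for instance $\mathbb C$, or $\mathbb C(\alpha)$ with $\alpha$ an indeterminate), let $\alpha\in F$ be not a non-positive rational number, put $\beta=1/\alpha$, and let $N\ge 0$. Let $z_1,\dots,z_N$ be commuting variables and $\phi_1,\dots,\phi_N,\theta_1,\dots,\theta_N$ mutually anticommuting variables; put $\partial_i=\partial/\partial z_i$, $\phi_i^\dagger=\partial/\partial\phi_i$, $\theta_i^\dagger=\partial/\partial\theta_i$, $z_{ij}=z_i-z_j$, $\phi_{ij}=\phi_i-\phi_j$, $\theta_{ij}=\theta_i-\theta_j$ (and likewise for $\dagger$). $K_{ij}$ exchanges $z_i$ and $z_j$; for $\omega\in S_N$, $\mathcal K_\omega$ permutes the triples $(z_i,\phi_i,\theta_i)$. Let $$\mathcal H=\sum_i (z_i\partial_i)^2+\beta\sum_{i<j}\frac{z_i+z_j}{z_{ij}}(z_i\partial_i-z_j\partial_j)-2\beta\sum_{i<j}\frac{z_iz_j}{z_{ij}^2}\bigl(1-(1-\phi_{ij}\phi_{ij}^\dagger)(1-\theta_{ij}\theta_{ij}^\dagger)\bigr),$$ $$\mathcal D_i=\alpha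 z_i\partial_i+\sum_{j<i}\frac{z_i}{z_{ij}}(1-K_{ij})+\sum_{j>i}\frac{z_j}{z_{ij}}(1-K_{ij})-(i-1).$$ A fermionic sector is a triple $M=(a,b,c)$ of non-negative integers with $a+b+c\le N$; put $M_1=a$, $M_2=a+b$, $M_3=a+b+c$, $[\phi;\theta]_M=\prod_{i\le M_1}\phi_i\theta_i\prod_{M_1<j\le M_2}\phi_j\prod_{M_2<k\le M_3}\theta_k$, let $\mathcal P^M$ be the projector onto the monomial $[\phi;\theta]_M$ (it keeps the terms with anticommuting part $[\phi;\theta]_M$ and kills those with any other monomial in the anticommuting variables), and let $Y_M=S_{\{1,\dots,M_1\}}\times S_{\{M_1+1,\dots,M_2\}}\times S_{\{M_2+1,\dots,M_3\}}\times S_{\{M_3+1,\dots,N\}}$. For $k=1,2,3$ let $$\mathcal I_{[k]}=\sum_M\frac1{|Y_M|}\sum_{\omega\in S_N}\mathcal K_\omega\,\mathcal P^M(\mathcal D_1+\dots+\mathcal D_{M_k}).$$ For a composition $\eta\in\mathbb Z_{\ge0}^N$ let $\eta^+$ be its weakly decreasing rearrangement and $w_\eta\in S_N$ the permutation of minimal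 length with $\eta=w_\eta\eta^+$. Write $\nu\prec\eta$ if $\nu^+<\eta^+$ in the dominance order, or $\nu^+=\eta^+$ and $w_\nu>w_\eta$ in the Bruhat order. The non-symmetric Jack polynomial $E_\eta$ is the unique polynomial $E_\eta=z^\eta+\sum_{\nu\prec\eta}a_{\eta\nu}z^\nu$ with $\mathcal D_iE_\eta=\widehat\eta_iE_\eta$ for all $i$, where $\widehat\eta_i=\alpha\eta_i-\#\{j<i:\eta_j\ge\eta_i\}-\#\{j>i:\eta_j>\eta_i\}$. A superpartition $\Lambda=(\Lambda_1,\dots,\Lambda_{M_1};\dots,\Lambda_{M_2};\dots,\Lambda_{M_3};\Lambda_{M_3+1},\dots,\Lambda_N)$ in the sector $M$ is a composition that is weakly decreasing on the first and last of the four blocks and strictly decreasing on the two middle ones (the last block is padded with zeros). Put $\Lambda^{[0]}=\Lambda^+$ and $\Lambda^{[k]}=(\Lambda+(1^{M_k},0^{N-M_k}))^+$ for $k=1,2,3$; let $\Lambda^R$ be $\Lambda$ with each block reversed, and let $f_\Lambda$ be the product of the factorials of the multiplicities of the parts of the first block (part $0$ included) and of the positive parts of the last block. The Jack superpolynomial is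 $$P_\Lambda=\frac{(-1)^{\binom b2+\binom c2}}{f_\Lambda}\sum_{\omega\in S_N}\mathcal K_\omega\,[\phi;\theta]_M\,E_{\Lambda^R}(z).$$ **Proposition.** For every superpartition $\Lambda$ (with $N$ entries) and $k=1,2,3$, $$\alpha^2\,\mathcal H\,P_\Lambda=\varepsilon_\Lambda(\alpha)\,P_\Lambda,\qquad \mathcal I_{[k]}\,P_\Lambda=\varepsilon^{[k]}_\Lambda(\alpha)\,P_\Lambda,$$ where $$\varepsilon_\Lambda(\alpha)=\sum_{i=1}^N\bigl[\alpha^2(\Lambda^{[0]}_i)^2+\alpha(N+1-2i)\Lambda^{[0]}_i\bigr],\qquad \varepsilon_\Lambda^{[k]}(\alpha)=\sum_{i:\ \Lambda^{[k]}_i\ne\Lambda^{[0]}_i}(\alpha\Lambda^{[0]}_i+1-i).$$ -/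

import Mathlib

noncomputable section

namespace SuperCS

open scoped TensorProduct
open MvPolynomial

/-! ## Commuting variables: exchange operators, divided differences, Dunkl operators

The variables are indexed by `Fin N`, so the index `i` of the usual notation is `i.val + 1`. -/

section Bosonic

variable {F : Type*} [Field F] {N : ℕ}

theorem sub_dvd_sub_swap (i j : Fin N) (f : MvPolynomial (Fin N) F) :
    (X i - X j : MvPolynomial (Fin N) F) ∣ f - rename (Equiv.swap i j) f := by
  induction f using MvPolynomial.induction_on with
  | C a => simp
  | add p q hp hq =>
    have h := dvd_add hp hq
    rw [map_add]
    convert h using 1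
    ring
  | mul_X p n hp =>
    have hn : (X i - X j : MvPolynomial (Fin N) F) ∣ X n - X (Equiv.swap i j n) := by
      by_cases h1 : n = i
      · subst h1; simp
      · by_cases h2 : n = j
        · subst h2
          rw [Equiv.swap_apply_right, ← neg_sub (X i) (X n), dvd_neg]
        · rw [Equiv.swap_apply_of_ne_of_ne h1 h2]; simp
    have h := dvd_add (Dvd.dvd.mul_right hp (X n))
      (Dvd.dvd.mul_left hn (rename (Equiv.swap i j) p))
    rw [map_mul, rename_X]
    convert h using 1
    ring

theorem X_sub_X_ne_zero {i j : Fin N} (h : i ≠ j) :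
    (X i - X j : MvPolynomial (Fin N) F) ≠ 0 :=
  fun h0 => h (X_injective (sub_eq_zero.mp h0))

/-- The divided difference `f ↦ (f - K_{ij} f) / (z_i - z_j)` for `i ≠ j`, where `K_{ij}`
exchanges `z_i` and `z_j`; the quotient is again a polynomial. -/
def divDiff (F : Type*) [Field F] {N : ℕ} (i j : Fin N) (hij : i ≠ j) :
    MvPolynomial (Fin N) F →ₗ[F] MvPolynomial (Fin N) F where
  toFun f := (sub_dvd_sub_swap i j f).choose
  map_add' f g := by
    apply mul_left_cancel₀ (X_sub_X_ne_zero (F := F) hij)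
    rw [mul_add, ← (sub_dvd_sub_swap i j (f + g)).choose_spec,
      ← (sub_dvd_sub_swap i j f).choose_spec, ← (sub_dvd_sub_swap i j g).choose_spec, map_add]
    ring
  map_smul' c f := by
    apply mul_left_cancel₀ (X_sub_X_ne_zero (F := F) hij)
    rw [RingHom.id_apply, mul_smul_comm, ← (sub_dvd_sub_swap i j (c • f)).choose_spec,
      ← (sub_dvd_sub_swap i j f).choose_spec, map_smul, smul_sub]

theorem divDiff_spec (i j : Fin N) (hij : i ≠ j) (f : MvPolynomial (Fin N) F) :
    (X i - X j) * divDiff F i j hij f = f - rename (Equiv.swap i j) f :=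
  (sub_dvd_sub_swap i j f).choose_spec.symm

/-- The Euler operator `z_i ∂_i`. -/
def euler (F : Type*) [Field F] {N : ℕ} (i : Fin N) :
    MvPolynomial (Fin N) F →ₗ[F] MvPolynomial (Fin N) F :=
  LinearMap.mulLeft F (X i) ∘ₗ (pderiv i).toLinearMap

/-- The Dunkl (Cherednik) operator
`D_i = α z_i ∂_i + ∑_{j<i} z_i/(z_i-z_j) (1-K_{ij}) + ∑_{j>i} z_j/(z_i-z_j) (1-K_{ij}) - (i-1)`;
with indices starting at `0` the last term is `- i`. -/
def dunkl (α : F) (i : Fin N) : MvPolynomial (Fin N) F →ₗ[F] MvPolynomial (Fin N) F :=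
  α • euler F i
    + (∑ j : Fin N, if h : j < i then LinearMap.mulLeft F (X i) ∘ₗ divDiff F i j h.ne' else 0)
    + (∑ j : Fin N, if h : i < j then LinearMap.mulLeft F (X j) ∘ₗ divDiff F i j h.ne else 0)
    - ((i : ℕ) : F) • LinearMap.id

end Bosonic

/-! ## Compositions, dominance order, Bruhat order -/

section Compositions

variable {N : ℕ}

/-- The weakly decreasing rearrangement `η⁺` of a composition. -/
def sortDesc (η : Fin N → ℕ) : Fin N → ℕ :=
  fun i => η (Tuple.sort (fun k => OrderDual.toDual (η k)) i)

theorem sortDesc_antitone (η : Fin N → ℕ) : Antitone (sortDesc η) :=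
  fun _ _ h => Tuple.monotone_sort (fun k => OrderDual.toDual (η k)) h

/-- Strict dominance order `μ < l` on partitions with `N` (possibly zero) parts. -/
def DominanceLT (μ l : Fin N → ℕ) : Prop :=
  μ ≠ l ∧ ∑ i, μ i = ∑ i, l i ∧
    ∀ k : Fin N, ∑ i ∈ Finset.Iic k, μ i ≤ ∑ i ∈ Finset.Iic k, l i

/-- The length of a permutation: its number of inversions. -/
def permLength (w : Equiv.Perm (Fin N)) : ℕ :=
  (Finset.univ.filter fun p : Fin N × Fin N => p.1 < p.2 ∧ w p.2 < w p.1).card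

/-- `l` is a reduced decomposition of `w` into simple transpositions. -/
def IsReducedWord (l : List (Equiv.Perm (Fin N))) (w : Equiv.Perm (Fin N)) : Prop :=
  (∀ s ∈ l, ∃ i j : Fin N, (j : ℕ) = (i : ℕ) + 1 ∧ s = Equiv.swap i j) ∧
    l.prod = w ∧ l.length = permLength w

/-- Strict Bruhat order on the symmetric group: `u < w` iff some reduced decomposition of `u`
is a subword of a reduced decomposition of `w`, and `u ≠ w`. -/
def BruhatLT (u w : Equiv.Perm (Fin N)) : Prop :=
  u ≠ w ∧ ∃ l' l : List (Equiv.Perm (Fin N)),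
    IsReducedWord l' u ∧ IsReducedWord l w ∧ l'.Sublist l

/-- `w` is the permutation `w_η` of minimal length with `η = w η⁺`, where `w` moves the entry in
position `i` to position `w i`. -/
def IsSortingPerm (η : Fin N → ℕ) (w : Equiv.Perm (Fin N)) : Prop :=
  (∀ i, η (w i) = sortDesc η i) ∧
    ∀ w' : Equiv.Perm (Fin N), (∀ i, η (w' i) = sortDesc η i) → permLength w ≤ permLength w'

/-- The order `ν ≺ η` on compositions: `ν⁺ < η⁺`, or `ν⁺ = η⁺` and `w_ν > w_η`. -/
def CompositionLT (ν η : Fin N → ℕ) : Prop :=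
  DominanceLT (sortDesc ν) (sortDesc η) ∨
    (sortDesc ν = sortDesc η ∧ ∃ u w : Equiv.Perm (Fin N),
      IsSortingPerm ν u ∧ IsSortingPerm η w ∧ BruhatLT w u)

end Compositions

/-! ## Non-symmetric Jack polynomials -/

section NonsymmetricJack

variable {F : Type*} [Field F] {N : ℕ}

/-- The eigenvalue
`η̂_i = α η_i - (#{j < i : η_j ≥ η_i} + #{j > i : η_j > η_i})`. -/
def etaHat (α : F) (η : Fin N → ℕ) (i : Fin N) : F :=
  α * (η i : F)
    - (((Finset.univ.filter fun j : Fin N => j < i ∧ η i ≤ η j).card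
      + (Finset.univ.filter fun j : Fin N => i < j ∧ η i < η j).card : ℕ) : F)

/-- The defining property of the non-symmetric Jack polynomial `E_η`:
`E = z^η + ∑_{ν ≺ η} a_ν z^ν` and `D_i E = η̂_i E` for all `i`. -/
def IsNonsymJack (α : F) (η : Fin N → ℕ) (E : MvPolynomial (Fin N) F) : Prop :=
  coeff (Finsupp.equivFunOnFinite.symm η) E = 1 ∧
    (∀ ν : Fin N →₀ ℕ, coeff ν E ≠ 0 → ⇑ν = η ∨ CompositionLT ⇑ν η) ∧
    ∀ i, dunkl α i E = etaHat α η i • E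

open Classical in
/-- The non-symmetric Jack polynomial `E_η`: the unique polynomial with the defining property.
(It exists and is unique as soon as `α` is not a non-positive rational number; the fallback value
is irrelevant then.) -/
def nonsymJack (α : F) (η : Fin N → ℕ) : MvPolynomial (Fin N) F :=
  if h : ∃! E : MvPolynomial (Fin N) F, IsNonsymJack α η E then h.choose else 0

end NonsymmetricJack

/-! ## Anticommuting variables -/

section Fermionic

/-- The Grassmann algebra over `F` on `φ_1, …, φ_N` (left summand) and `θ_1, …, θ_N`
(right summand). -/
abbrev Grassmann (F : Type*) [Field F] (N : ℕ) : Type _ :=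
  ExteriorAlgebra F (Fin N ⊕ Fin N →₀ F)

variable (F : Type*) [Field F] {N : ℕ}

/-- The generators: `gen (inl i) = φ_i` and `gen (inr i) = θ_i`. -/
def gen (x : Fin N ⊕ Fin N) : Grassmann F N :=
  ExteriorAlgebra.ι F (Finsupp.single x (1 : F))

/-- The left derivative with respect to a generator; this is `φ_i† = ∂/∂φ_i` for `inl i` and
`θ_i† = ∂/∂θ_i` for `inr i`. -/
def genDeriv (x : Fin N ⊕ Fin N) : Module.End F (Grassmann F N) :=
  CliffordAlgebra.contractLeft (Q := (0 : QuadraticForm F (Fin N ⊕ Fin N →₀ F)))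
    (Finsupp.lapply x)

/-- `1 - φ_{ij} φ_{ij}†`, where `φ_{ij} = φ_i - φ_j` and `φ_{ij}† = φ_i† - φ_j†`. -/
def kappaPhi (i j : Fin N) : Module.End F (Grassmann F N) :=
  1 - LinearMap.mulLeft F (gen F (Sum.inl i) - gen F (Sum.inl j))
    * (genDeriv F (Sum.inl i) - genDeriv F (Sum.inl j))

/-- `1 - θ_{ij} θ_{ij}†`, where `θ_{ij} = θ_i - θ_j` and `θ_{ij}† = θ_i† - θ_j†`. -/
def kappaTheta (i j : Fin N) : Module.End F (Grassmann F N) :=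
  1 - LinearMap.mulLeft F (gen F (Sum.inr i) - gen F (Sum.inr j))
    * (genDeriv F (Sum.inr i) - genDeriv F (Sum.inr j))

/-- The action of a permutation on the Grassmann algebra: `φ_i ↦ φ_{ω i}`, `θ_i ↦ θ_{ω i}`. -/
def grassmannPerm (ω : Equiv.Perm (Fin N)) : Grassmann F N →ₗ[F] Grassmann F N :=
  (ExteriorAlgebra.map (Finsupp.lmapDomain F F (Sum.map ω ω))).toLinearMap

/-- A fermionic sector `M` is given by three numbers: `m 0` counts the pairs `φ_i θ_i`, `m 1` the
unpaired `φ_j`, `m 2` the unpaired `θ_k`. The partial sums are `M_1 = m 0`, `M_2 = m 0 + m 1`,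
`M_3 = m 0 + m 1 + m 2`; here `partialSum m k` is `M_{k+1}`. -/
def partialSum (m : Fin 3 → ℕ) (k : Fin 3) : ℕ := ∑ j ∈ Finset.Iic k, m j

theorem partialSum_zero (m : Fin 3 → ℕ) : partialSum m 0 = m 0 := by
  rw [partialSum, show Finset.Iic (0 : Fin 3) = {0} by decide, Finset.sum_singleton]

theorem partialSum_one (m : Fin 3 → ℕ) : partialSum m 1 = m 0 + m 1 := by
  rw [partialSum, show Finset.Iic (1 : Fin 3) = {0, 1} by decide, Finset.sum_pair (by decide)]

theorem partialSum_two (m : Fin 3 → ℕ) : partialSum m 2 = m 0 + m 1 + m 2 := by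
  rw [partialSum, show Finset.Iic (2 : Fin 3) = Finset.univ by decide, Fin.sum_univ_three]

/-- All fermionic sectors in `N` variables. -/
def sectors (N : ℕ) : Finset (Fin 3 → ℕ) :=
  (Fintype.piFinset fun _ => Finset.range (N + 1)).filter fun m => partialSum m 2 ≤ N

/-- The ordered list of the generators in `[φ;θ]_M`:
`φ_1 θ_1 ⋯ φ_{M_1} θ_{M_1}`, then `φ_{M_1+1} ⋯ φ_{M_2}`, then `θ_{M_2+1} ⋯ θ_{M_3}`. -/
def fermionWord (N : ℕ) (m : Fin 3 → ℕ) : List (Fin N ⊕ Fin N) :=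
  ((List.finRange N).filter fun i : Fin N => (i : ℕ) < partialSum m 0).flatMap
      (fun i => [Sum.inl i, Sum.inr i])
    ++ ((List.finRange N).filter fun i : Fin N =>
        partialSum m 0 ≤ (i : ℕ) ∧ (i : ℕ) < partialSum m 1).map Sum.inl
    ++ ((List.finRange N).filter fun i : Fin N =>
        partialSum m 1 ≤ (i : ℕ) ∧ (i : ℕ) < partialSum m 2).map Sum.inr

/-- The monomial `[φ;θ]_M`. -/
def fermionMonomial (N : ℕ) (m : Fin 3 → ℕ) : Grassmann F N :=
  ((fermionWord N m).map (gen F)).prod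

/-- The adjoint operator `[φ;θ]_M†`: the product of the derivatives in the reverse order. -/
def fermionMonomialAdj (N : ℕ) (m : Fin 3 → ℕ) : Module.End F (Grassmann F N) :=
  ((fermionWord N m).map (genDeriv F)).reverse.prod

/-- The projector `P^M` onto the monomial term `[φ;θ]_M`: it applies `[φ;θ]_M†`, keeps the term
of degree zero, and multiplies by `[φ;θ]_M`. Hence `[φ;θ]_M` is fixed, and every other monomial in
the anticommuting variables is sent to `0`. -/
def fermionProj (N : ℕ) (m : Fin 3 → ℕ) : Module.End F (Grassmann F N) :=
  LinearMap.toSpanSingleton F (Grassmann F N) (fermionMonomial F N m)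
    ∘ₗ (ExteriorAlgebra.algebraMapInv
        (R := F) (M := Fin N ⊕ Fin N →₀ F)).toLinearMap ∘ₗ fermionMonomialAdj F N m

end Fermionic

/-! ## Superpolynomials and the operators acting on them -/

section Super

/-- Superpolynomials: polynomials in `z_1, …, z_N` and the anticommuting `φ_i`, `θ_i`. -/
abbrev SuperPoly (F : Type*) [Field F] (N : ℕ) : Type _ :=
  MvPolynomial (Fin N) F ⊗[F] Grassmann F N

/-- Superfunctions whose coefficients are rational functions of `z_1, …, z_N`. -/
abbrev SuperRat (F : Type*) [Field F] (N : ℕ) : Type _ :=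
  FractionRing (MvPolynomial (Fin N) F) ⊗[F] Grassmann F N

variable {F : Type*} [Field F] {N : ℕ}

/-- The inclusion of polynomials in rational functions. -/
def polyToRat (F : Type*) [Field F] (N : ℕ) :
    MvPolynomial (Fin N) F →ₗ[F] FractionRing (MvPolynomial (Fin N) F) :=
  (IsScalarTower.toAlgHom F (MvPolynomial (Fin N) F)
    (FractionRing (MvPolynomial (Fin N) F))).toLinearMap

/-- The inclusion of superpolynomials in rational superfunctions. -/
def superToRat (F : Type*) [Field F] (N : ℕ) : SuperPoly F N →ₗ[F] SuperRat F N :=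
  TensorProduct.map (polyToRat F N) LinearMap.id

/-- `K_ω`, the simultaneous permutation of the triples `(z_i, φ_i, θ_i)`. -/
def superPerm (F : Type*) [Field F] {N : ℕ} (ω : Equiv.Perm (Fin N)) :
    SuperPoly F N →ₗ[F] SuperPoly F N :=
  TensorProduct.map (rename (R := F) ω).toLinearMap (grassmannPerm F ω)

/-- The variable `z_i` as a rational function. -/
def ratVar (F : Type*) [Field F] {N : ℕ} (i : Fin N) : FractionRing (MvPolynomial (Fin N) F) :=
  algebraMap (MvPolynomial (Fin N) F) (FractionRing (MvPolynomial (Fin N) F)) (X i)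

/-- The supersymmetric Calogero–Sutherland Hamiltonian with coupling `β`, acting on
superpolynomials, with values in rational superfunctions:
`∑_i (z_i ∂_i)² + β ∑_{i<j} (z_i+z_j)/(z_i-z_j) (z_i ∂_i - z_j ∂_j)
  - 2 β ∑_{i<j} z_i z_j/(z_i-z_j)² (1 - (1 - φ_{ij} φ_{ij}†)(1 - θ_{ij} θ_{ij}†))`. -/
def hamiltonian (N : ℕ) (β : F) : SuperPoly F N →ₗ[F] SuperRat F N :=
  (∑ i : Fin N, TensorProduct.map (polyToRat F N ∘ₗ euler F i ∘ₗ euler F i) LinearMap.id)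
  + β • (∑ i : Fin N, ∑ j ∈ Finset.Ioi i,
      TensorProduct.map
        (LinearMap.mulLeft F ((ratVar F i + ratVar F j) / (ratVar F i - ratVar F j))
          ∘ₗ polyToRat F N ∘ₗ (euler F i - euler F j))
        LinearMap.id)
  - (2 * β) • (∑ i : Fin N, ∑ j ∈ Finset.Ioi i,
      TensorProduct.map
        (LinearMap.mulLeft F (ratVar F i * ratVar F j / (ratVar F i - ratVar F j) ^ 2)
          ∘ₗ polyToRat F N)
        (1 - kappaPhi F i j * kappaTheta F i j))

/-- The order of `S_{M_1} × S_{]M_1,M_2]} × S_{]M_2,M_3]} × S_{]M_3,N]}`. -/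
def youngCard (N : ℕ) (m : Fin 3 → ℕ) : ℕ :=
  (m 0).factorial * (m 1).factorial * (m 2).factorial * (N - partialSum m 2).factorial

/-- The conserved quantity `I_{[k+1]}`, for `k = 0, 1, 2`:
`∑_M (1 / |S_{M_1} × S_{]M_1,M_2]} × S_{]M_2,M_3]} × S_{]M_3,N]}|)
  ∑_{ω ∈ S_N} K_ω P^M (D_1 + ⋯ + D_{M_{k+1}})`. -/
def conserved (N : ℕ) (α : F) (k : Fin 3) : Module.End F (SuperPoly F N) :=
  ∑ m ∈ sectors N, ((youngCard N m : F)⁻¹) • ∑ ω : Equiv.Perm (Fin N),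
    superPerm F ω ∘ₗ TensorProduct.map LinearMap.id (fermionProj F N m)
      ∘ₗ TensorProduct.map
        (∑ i ∈ Finset.univ.filter (fun i : Fin N => (i : ℕ) < partialSum m k), dunkl α i)
        LinearMap.id

end Super

/-! ## Superpartitions and Jack superpolynomials -/

/-- A superpartition of length at most `N`, written `(Λ_1,…,Λ_{M_1}; …; …; Λ_{M_3+1},…,Λ_N)` in the
sector `M = (m 0, m 1, m 2)`: the first and last blocks are weakly decreasing (the last one padded
with zeros), the two middle blocks are strictly decreasing. -/
structure SuperPartition (N : ℕ) where
  m : Fin 3 → ℕ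
  le_card : partialSum m 2 ≤ N
  parts : Fin N → ℕ
  antitone_first : ∀ i j : Fin N, i < j → (j : ℕ) < partialSum m 0 → parts j ≤ parts i
  strict_second : ∀ i j : Fin N, i < j → partialSum m 0 ≤ (i : ℕ) → (j : ℕ) < partialSum m 1 →
    parts j < parts i
  strict_third : ∀ i j : Fin N, i < j → partialSum m 1 ≤ (i : ℕ) → (j : ℕ) < partialSum m 2 →
    parts j < parts i
  antitone_last : ∀ i j : Fin N, i < j → partialSum m 2 ≤ (i : ℕ) → parts j ≤ parts i

namespace SuperPartition

variable {N : ℕ} (L : SuperPartition N)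

/-- `Λ^[0] = Λ⁺`. -/
def bosonic : Fin N → ℕ := sortDesc L.parts

/-- `Λ^[k+1] = (Λ + 1^{M_{k+1}})⁺` for `k = 0, 1, 2`. -/
def shifted (k : Fin 3) : Fin N → ℕ :=
  sortDesc fun i => L.parts i + if (i : ℕ) < partialSum L.m k then 1 else 0

/-- The reversal of positions inside each of the four blocks. -/
def blockRev (i : Fin N) : Fin N :=
  have hi := i.isLt
  have hN := L.le_card
  have h0 := partialSum_zero L.m
  have h1 := partialSum_one L.m
  have h2 := partialSum_two L.m
  if _ : (i : ℕ) < partialSum L.m 0 then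
    ⟨partialSum L.m 0 - 1 - i, by omega⟩
  else if _ : (i : ℕ) < partialSum L.m 1 then
    ⟨partialSum L.m 0 + (partialSum L.m 1 - 1 - i), by omega⟩
  else if _ : (i : ℕ) < partialSum L.m 2 then
    ⟨partialSum L.m 1 + (partialSum L.m 2 - 1 - i), by omega⟩
  else
    ⟨partialSum L.m 2 + (N - 1 - i), by omega⟩

/-- `Λ^R`: each of the four blocks is written in the reverse order. -/
def rev : Fin N → ℕ := fun i => L.parts (L.blockRev i)

/-- `f_Λ`: the product of the factorials of the multiplicities of the parts of the first block
(zero included) and of the positive parts of the last block. -/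
def norm : ℕ :=
  (∏ v ∈ Finset.univ.image L.parts,
    (Finset.univ.filter fun i : Fin N =>
      (i : ℕ) < partialSum L.m 0 ∧ L.parts i = v).card.factorial) *
  (∏ v ∈ (Finset.univ.image L.parts).filter (0 < ·),
    (Finset.univ.filter fun i : Fin N =>
      partialSum L.m 2 ≤ (i : ℕ) ∧ L.parts i = v).card.factorial)

end SuperPartition

/-- The Jack superpolynomial
`P_Λ = (-1)^{binom(m 1, 2) + binom(m 2, 2)} / f_Λ ∑_{ω ∈ S_N} K_ω [φ;θ]_M E_{Λ^R}(z)`. -/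
def jackSuper {F : Type*} [Field F] {N : ℕ} (α : F) (L : SuperPartition N) : SuperPoly F N :=
  ((-1 : F) ^ ((L.m 1).choose 2 + (L.m 2).choose 2) / (L.norm : F)) •
    ∑ ω : Equiv.Perm (Fin N), superPerm F ω (nonsymJack α L.rev ⊗ₜ[F] fermionMonomial F N L.m)

/-- `∑_i [α² (Λ^[0]_i)² + α (N + 1 - 2 i) Λ^[0]_i]`, the index starting at `1`. -/
def energy {F : Type*} [Field F] {N : ℕ} (α : F) (L : SuperPartition N) : F :=
  ∑ i : Fin N, (α ^ 2 * (L.bosonic i : F) ^ 2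
    + α * ((N : F) + 1 - 2 * (((i : ℕ) : F) + 1)) * (L.bosonic i : F))

/-- `∑ (α Λ^[0]_i + 1 - i)` over the `i` with `Λ^[k+1]_i ≠ Λ^[0]_i`, the index starting at `1`. -/
def charge {F : Type*} [Field F] {N : ℕ} (α : F) (L : SuperPartition N) (k : Fin 3) : F :=
  ∑ i ∈ Finset.univ.filter (fun i : Fin N => L.shifted k i ≠ L.bosonic i),
    (α * (L.bosonic i : F) + 1 - (((i : ℕ) : F) + 1))

end SuperCS

end

/-! A Jack superpolynomial is, up to a constant, the symmetrization of `E ⊗ [φ;θ]_M`, where `E` is a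
joint eigenfunction of the Dunkl operators. Only these eigenvalue equations for `E` enter the proof;
the triangular expansion does not.

Hamiltonian. The fermionic factor in each interaction term is the exchange of `(φ_i, θ_i)` with
`(φ_j, θ_j)` (`kappaPhi_mul_kappaTheta`). On an invariant superpolynomial it acts as the exchange of
`z_i` and `z_j`, so the Hamiltonian becomes an operator in the commuting variables alone: `calogero`
divided by `4 α²` (`hamiltonian_eq_calogero`). This operator commutes with all permutations, so it
may be evaluated on `E`. There it is a sum of squares: write `2 D_i + (N - 1) = A_i + B_i` with
`A_i` permutation-covariant (`covariantDunkl`) and `B_i` a signed sum of exchanges (`signedSwaps`).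
In `∑ (A_i + B_i)²` the cross terms cancel by antisymmetry. The three-body terms of `∑ A_i²` and `∑
B_i²` cancel up to a scalar, because `(z_i + z_j)/(z_i - z_j)` and `sign(j - i)` satisfy the same
cyclic quadratic identity (`threeBody_perm_sum`). What remains is `calogero` plus a scalar
(`calogero_eq_of_dunkl_eq`).

Charges. In `D_1 + ⋯ + D_n` the exchanges within `{1, …, n}` cancel, so the sum commutes with every
permutation preserving that set (`rename_sum_dunkl`). The projector keeps exactly the terms of the
symmetrization whose permutation preserves the blocks of `M`. For these the sum passes through the
permutation and acts on `E`, and their number is cancelled by `1/|Y_M|`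
(`conserved_symmetrization`).

Eigenvalues. At the `p`-th entry in stable decreasing order, `η̂` equals `α η⁺_p - p`, with `p`
counted from zero (`etaHat_stableSort`). The same sorting stays valid after adding `1` to the first
`M_k` entries, which identifies the rows counted by the charge. -/

noncomputable section

namespace SuperCS

open scoped TensorProduct
open MvPolynomial

/-! ### Exchange operators and the splitting of the Dunkl operators -/

section Bosonic

variable {F : Type*} [Field F] {N : ℕ}

/-- The operator `f ↦ (z_i + z_j)/(z_i - z_j) (f - K_{ij} f)`. -/
def symDivDiff (F : Type*) [Field F] {N : ℕ} (i j : Fin N) :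
    MvPolynomial (Fin N) F →ₗ[F] MvPolynomial (Fin N) F :=
  if h : i = j then 0 else LinearMap.mulLeft F (X i + X j) ∘ₗ divDiff F i j h

theorem symDivDiff_self (i : Fin N) : symDivDiff F i i = 0 := by simp [symDivDiff]

theorem symDivDiff_spec (i j : Fin N) (f : MvPolynomial (Fin N) F) :
    (X i - X j) * symDivDiff F i j f = (X i + X j) * (f - rename (Equiv.swap i j) f) := by
  by_cases h : i = j
  · subst h; simp
  · rw [symDivDiff, dif_neg h, LinearMap.comp_apply, LinearMap.mulLeft_apply, mul_left_comm,
      divDiff_spec]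

theorem symDivDiff_symm (i j : Fin N) : symDivDiff F j i = -symDivDiff F i j := by
  by_cases h : i = j
  · subst h; simp [symDivDiff_self]
  · refine LinearMap.ext fun f => ?_
    apply mul_left_cancel₀ (X_sub_X_ne_zero (F := F) h)
    have h1 := symDivDiff_spec i j f
    have h2 := symDivDiff_spec j i f
    rw [Equiv.swap_comm] at h2
    rw [LinearMap.neg_apply]
    linear_combination h1 - h2

theorem rename_rename_perm (σ τ : Equiv.Perm (Fin N)) (f : MvPolynomial (Fin N) F) :
    rename σ (rename τ f) = rename (σ * τ) f := by
  rw [rename_rename]; rfl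

theorem rename_symDivDiff (σ : Equiv.Perm (Fin N)) (i j : Fin N) (f : MvPolynomial (Fin N) F) :
    rename σ (symDivDiff F i j f) = symDivDiff F (σ i) (σ j) (rename σ f) := by
  by_cases h : i = j
  · subst h; simp [symDivDiff_self]
  · apply mul_left_cancel₀ (X_sub_X_ne_zero (F := F) (σ.injective.ne h))
    have h1 := congrArg (rename (R := F) σ) (symDivDiff_spec i j f)
    simp only [map_mul, map_sub, map_add, rename_X, rename_rename_perm] at h1
    rw [h1, symDivDiff_spec, rename_rename_perm, Equiv.swap_apply_apply]
    simp [mul_assoc]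

/-- Both `(z_i + z_j)/(z_i - z_j)` and `f - K_{ij} f` change sign under `K_{ij}`, so their product
is symmetric and is killed by `1 - K_{ij}`. -/
theorem symDivDiff_symDivDiff (i j : Fin N) (f : MvPolynomial (Fin N) F) :
    symDivDiff F i j (symDivDiff F i j f) = 0 := by
  by_cases h : i = j
  · subst h; simp [symDivDiff_self]
  · apply mul_left_cancel₀ (X_sub_X_ne_zero (F := F) h)
    have h3 : symDivDiff F i j (rename (Equiv.swap i j) f) = -symDivDiff F i j f := by
      apply mul_left_cancel₀ (X_sub_X_ne_zero (F := F) h)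
      have h1 := symDivDiff_spec i j f
      have h2 := symDivDiff_spec i j (rename (Equiv.swap i j) f)
      rw [rename_rename_perm, Equiv.swap_mul_self] at h2
      simp only [Equiv.Perm.coe_one, rename_id_apply] at h2
      linear_combination h1 + h2
    rw [symDivDiff_spec, rename_symDivDiff, Equiv.swap_apply_left, Equiv.swap_apply_right,
      symDivDiff_symm i j, LinearMap.neg_apply, h3]
    ring

theorem euler_apply (i : Fin N) (f : MvPolynomial (Fin N) F) :
    euler F i f = X i * pderiv i f := rfl

theorem euler_mul (i : Fin N) (f g : MvPolynomial (Fin N) F) :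
    euler F i (f * g) = euler F i f * g + f * euler F i g := by
  simp only [euler_apply, Derivation.leibniz, smul_eq_mul]; ring

theorem euler_X_self (i : Fin N) : euler F i (X i) = X i := by
  simp [euler_apply]

theorem euler_X_of_ne {i j : Fin N} (h : j ≠ i) : euler F i (X j) = 0 := by
  simp [euler_apply, pderiv_X_of_ne h]

theorem rename_euler (σ : Equiv.Perm (Fin N)) (i : Fin N) (f : MvPolynomial (Fin N) F) :
    rename σ (euler F i f) = euler F (σ i) (rename σ f) := by
  rw [euler_apply, euler_apply, map_mul, rename_X, pderiv_rename σ.injective]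

/-- The sign of `j - i`. -/
def orderSign (F : Type*) [Field F] {N : ℕ} (i j : Fin N) : F :=
  if i < j then 1 else if j < i then -1 else 0

theorem orderSign_self (i : Fin N) : orderSign F i i = 0 := by simp [orderSign]

theorem orderSign_symm (i j : Fin N) : orderSign F j i = -orderSign F i j := by
  unfold orderSign
  rcases lt_trichotomy i j with h | h | h
  · simp [h, h.not_gt]
  · simp [h]
  · simp [h, h.not_gt]

theorem sum_orderSign (i : Fin N) : ∑ j, orderSign F i j = (N : F) - 1 - 2 * ((i : ℕ) : F) := by
  have h : ∀ j : Fin N, orderSign F i j = (if i < j then 1 else 0) - (if j < i then 1 else 0) := by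
    intro j
    unfold orderSign
    rcases lt_trichotomy i j with h | h | h
    · simp [h, h.not_gt]
    · simp [h]
    · simp [h, h.not_gt]
  have h1 : (Finset.univ.filter fun j => i < j).card = N - 1 - i := by
    rw [← Fin.card_Ioi]; congr 1; ext; simp
  have h2 : (Finset.univ.filter fun j => j < i).card = i := by
    rw [← Fin.card_Iio i]; congr 1; ext; simp
  simp only [h, Finset.sum_sub_distrib, Finset.sum_boole, h1, h2]
  have hi := i.isLt
  rw [Nat.sub_sub, Nat.cast_sub (by omega)]
  push_cast; ring

/-- `2 α z_i ∂_i + ∑_j (z_i + z_j)/(z_i - z_j) (1 - K_{ij})`, the part of `2 D_i` on which the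
symmetric group acts by permuting the indices. -/
def covariantDunkl (α : F) (i : Fin N) : MvPolynomial (Fin N) F →ₗ[F] MvPolynomial (Fin N) F :=
  (2 * α) • euler F i + ∑ j, symDivDiff F i j

/-- `∑_j sign(j - i) K_{ij}`. -/
def signedSwaps (F : Type*) [Field F] {N : ℕ} (i : Fin N) :
    MvPolynomial (Fin N) F →ₗ[F] MvPolynomial (Fin N) F :=
  ∑ j, orderSign F i j • (rename (R := F) (Equiv.swap i j)).toLinearMap

theorem signedSwaps_apply (i : Fin N) (f : MvPolynomial (Fin N) F) :
    signedSwaps F i f = ∑ j, orderSign F i j • rename (Equiv.swap i j) f := by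
  simp [signedSwaps, LinearMap.sum_apply]

theorem covariantDunkl_apply (α : F) (i : Fin N) (f : MvPolynomial (Fin N) F) :
    covariantDunkl α i f = (2 * α) • euler F i f + ∑ j, symDivDiff F i j f := by
  simp [covariantDunkl, LinearMap.sum_apply]

/-- From `2 z_i/(z_i - z_j) = (z_i + z_j)/(z_i - z_j) + 1` and `2 z_j/(z_i - z_j) = (z_i + z_j)/(z_i
- z_j) - 1`. The signs sum to `N - 1 - 2 i`, which combines with the term `-2 i` into a shift
independent of `i`; this is why the non-covariant index term of `D_i` is harmless. -/
theorem two_smul_dunkl (α : F) (i : Fin N) (f : MvPolynomial (Fin N) F) :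
    (2 : F) • dunkl α i f
      = covariantDunkl α i f + signedSwaps F i f - ((N : F) - 1) • f := by
  have key : ∀ j : Fin N,
      (2 : F) • ((if h : j < i then LinearMap.mulLeft F (X i) ∘ₗ divDiff F i j h.ne' else 0) f)
        + (2 : F) • ((if h : i < j then LinearMap.mulLeft F (X j) ∘ₗ divDiff F i j h.ne else 0) f)
      = symDivDiff F i j f + orderSign F i j • rename (Equiv.swap i j) f
        - orderSign F i j • f := by
    intro j
    rcases lt_trichotomy i j with h | h | h
    · have := divDiff_spec i j h.ne f
      simp only [h, h.not_gt, h.ne, dite_true, dite_false, symDivDiff, orderSign, if_true,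
        LinearMap.zero_apply, LinearMap.comp_apply, LinearMap.mulLeft_apply, one_smul, smul_zero,
        two_smul]
      linear_combination -this
    · subst h
      simp [symDivDiff_self, orderSign_self]
    · have := divDiff_spec i j h.ne' f
      simp only [h, h.not_gt, h.ne', dite_true, dite_false, symDivDiff, orderSign, if_true,
        if_false, LinearMap.zero_apply, LinearMap.comp_apply, LinearMap.mulLeft_apply, one_smul,
        smul_zero, two_smul, neg_smul]
      linear_combination this
  have hs := Finset.sum_congr (rfl : (Finset.univ : Finset (Fin N)) = _) fun j _ => key j
  rw [Finset.sum_add_distrib, Finset.sum_sub_distrib, Finset.sum_add_distrib, ← Finset.smul_sum,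
    ← Finset.smul_sum, ← Finset.sum_smul, sum_orderSign] at hs
  rw [covariantDunkl_apply, signedSwaps_apply]
  simp only [dunkl, LinearMap.sub_apply, LinearMap.add_apply, LinearMap.smul_apply,
    LinearMap.sum_apply, LinearMap.id_apply, smul_sub, smul_add, smul_smul]
  rw [add_assoc, hs]
  module

theorem rename_covariantDunkl (α : F) (σ : Equiv.Perm (Fin N)) (i : Fin N)
    (f : MvPolynomial (Fin N) F) :
    rename σ (covariantDunkl α i f) = covariantDunkl α (σ i) (rename σ f) := by
  simp only [covariantDunkl_apply, map_add, map_smul, map_sum, rename_euler, rename_symDivDiff]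
  rw [Equiv.sum_comp σ fun j => symDivDiff F (σ i) j (rename σ f)]

/-- The Calogero–Sutherland operator on polynomials, with the exchange operators in place of the
anticommuting variables and multiplied by `4 α²`. -/
def calogero (N : ℕ) (α : F) : MvPolynomial (Fin N) F →ₗ[F] MvPolynomial (Fin N) F :=
  (4 * α ^ 2) • (∑ i, euler F i ∘ₗ euler F i)
    + (2 * α) • ∑ i, ∑ j, (euler F i ∘ₗ symDivDiff F i j + symDivDiff F i j ∘ₗ euler F i)

theorem calogero_apply (α : F) (f : MvPolynomial (Fin N) F) :
    calogero N α f = (4 * α ^ 2) • (∑ i, euler F i (euler F i f))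
      + (2 * α) • ∑ i, ∑ j, (euler F i (symDivDiff F i j f) + symDivDiff F i j (euler F i f)) := by
  simp [calogero, LinearMap.sum_apply]

theorem rename_calogero (α : F) (σ : Equiv.Perm (Fin N)) (f : MvPolynomial (Fin N) F) :
    rename σ (calogero N α f) = calogero N α (rename σ f) := by
  have h1 : ∑ i, euler F (σ i) (euler F (σ i) (rename σ f))
      = ∑ i, euler F i (euler F i (rename σ f)) :=
    Equiv.sum_comp σ fun i => euler F i (euler F i (rename σ f))
  have h2 : ∑ i, ∑ j, (euler F (σ i) (symDivDiff F (σ i) (σ j) (rename σ f))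
        + symDivDiff F (σ i) (σ j) (euler F (σ i) (rename σ f)))
      = ∑ i, ∑ j, (euler F i (symDivDiff F i j (rename σ f))
        + symDivDiff F i j (euler F i (rename σ f))) :=
    (Finset.sum_congr rfl fun i _ => Equiv.sum_comp σ fun j =>
      euler F (σ i) (symDivDiff F (σ i) j (rename σ f))
        + symDivDiff F (σ i) j (euler F (σ i) (rename σ f))).trans
    (Equiv.sum_comp σ fun i => ∑ j, (euler F i (symDivDiff F i j (rename σ f))
        + symDivDiff F i j (euler F i (rename σ f))))
  simp only [calogero_apply, map_add, map_smul, map_sum, rename_euler, rename_symDivDiff]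
  rw [h1, h2]

theorem sum_covariantDunkl_sq (α : F) (f : MvPolynomial (Fin N) F) :
    ∑ i, covariantDunkl α i (covariantDunkl α i f)
      = calogero N α f + ∑ i, ∑ j, ∑ k, symDivDiff F i j (symDivDiff F i k f) := by
  have key : ∀ i, covariantDunkl α i (covariantDunkl α i f)
      = (4 * α ^ 2) • euler F i (euler F i f)
        + (2 * α) • ∑ j, (euler F i (symDivDiff F i j f) + symDivDiff F i j (euler F i f))
        + ∑ j, ∑ k, symDivDiff F i j (symDivDiff F i k f) := by
    intro i
    simp only [covariantDunkl_apply, map_add, map_sum, map_smul, smul_add,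
      Finset.sum_add_distrib, ← Finset.smul_sum, smul_smul]
    rw [show 2 * α * (2 * α) = 4 * α ^ 2 by ring]
    generalize (4 * α ^ 2) • euler F i (euler F i f) = a
    generalize (2 * α) • ∑ j, euler F i (symDivDiff F i j f) = b
    generalize (2 * α) • ∑ j, symDivDiff F i j (euler F i f) = c
    rw [Finset.sum_comm (f := fun j k => symDivDiff F i j (symDivDiff F i k f))]
    generalize ∑ k, ∑ j, symDivDiff F i j (symDivDiff F i k f) = d
    abel
  rw [Finset.sum_congr rfl fun i _ => key i, Finset.sum_add_distrib, Finset.sum_add_distrib,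
    ← Finset.smul_sum, ← Finset.smul_sum, calogero_apply]

/-- A sum over ordered pairs of an antisymmetric expression vanishes. -/
theorem sum_sum_eq_zero_of_antisymm [CharZero F] {V : Type*} [AddCommGroup V] [Module F V]
    (s : Finset (Fin N)) (t : Fin N → Fin N → V) (h : ∀ i j, t j i = -t i j) :
    ∑ i ∈ s, ∑ j ∈ s, t i j = 0 := by
  have h1 : ∑ i ∈ s, ∑ j ∈ s, t i j = -∑ i ∈ s, ∑ j ∈ s, t i j := by
    conv_lhs => rw [Finset.sum_comm]
    simp only [← Finset.sum_neg_distrib, ← h]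
  have h2 : (2 : F) • ∑ i ∈ s, ∑ j ∈ s, t i j = 0 := by
    rw [two_smul]; nth_rewrite 1 [h1]; simp
  exact (smul_eq_zero.mp h2).resolve_left two_ne_zero

/-- Covariance moves `K_{ij}` to the left: the pair `(i, j)` contributes `sign(j - i)` times `A_i
K_{ij} + A_j K_{ij}`, where `A_i` is `covariantDunkl α i`, and this is antisymmetric in `i, j`. -/
theorem sum_covariantDunkl_signedSwaps [CharZero F] (α : F) (f : MvPolynomial (Fin N) F) :
    ∑ i, (covariantDunkl α i (signedSwaps F i f) + signedSwaps F i (covariantDunkl α i f)) = 0 := by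
  simp only [signedSwaps_apply, map_sum, map_smul, rename_covariantDunkl, Equiv.swap_apply_left,
    ← Finset.sum_add_distrib, ← smul_add]
  apply sum_sum_eq_zero_of_antisymm (F := F)
  intro i j
  rw [orderSign_symm, Equiv.swap_comm, neg_smul, add_comm]

/-! ### The three-body identity -/

/-- The rational function `(z_i + z_j)/(z_i - z_j)`. -/
def ratCot (F : Type*) [Field F] {N : ℕ} (i j : Fin N) : FractionRing (MvPolynomial (Fin N) F) :=
  (ratVar F i + ratVar F j) / (ratVar F i - ratVar F j)

theorem ratVar_sub_ne_zero {i j : Fin N} (h : i ≠ j) : ratVar F i - ratVar F j ≠ 0 := by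
  rw [ratVar, ratVar, ← map_sub]
  exact fun h0 => X_sub_X_ne_zero (F := F) h
    ((injective_iff_map_eq_zero _).mp (IsFractionRing.injective _ _) _ h0)

theorem ratCot_symm (i j : Fin N) : ratCot F j i = -ratCot F i j := by
  rw [ratCot, ratCot, ← neg_sub (ratVar F i), div_neg, add_comm]

/-- The addition formula of the cotangent: for `z_j = exp(√-1 x_j)`, `ratCot` is `-√-1` times the
cotangent of half the difference of the angles. -/
theorem ratCot_cyclic {i j k : Fin N} (hij : i ≠ j) (hik : i ≠ k) (hjk : j ≠ k) :
    ratCot F i j * ratCot F i k + ratCot F j k * ratCot F j i + ratCot F k i * ratCot F k j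
      = 1 := by
  have h1 := ratVar_sub_ne_zero (F := F) hij
  have h2 := ratVar_sub_ne_zero (F := F) hik
  have h3 := ratVar_sub_ne_zero (F := F) hjk
  rw [ratCot_symm i j, ratCot_symm i k, ratCot_symm j k]
  unfold ratCot
  field_simp
  ring

/-- The degenerate case of `ratCot_cyclic`: for `|z_1| ≫ |z_2| ≫ ⋯` the ratio `(z_i + z_j)/(z_i -
z_j)` tends to the sign of `j - i`. -/
theorem orderSign_cyclic {i j k : Fin N} (hij : i ≠ j) (hik : i ≠ k) (hjk : j ≠ k) :
    orderSign F i j * orderSign F i k + orderSign F j k * orderSign F j i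
      + orderSign F k i * orderSign F k j = 1 := by
  rw [orderSign_symm i j, orderSign_symm i k, orderSign_symm j k]
  unfold orderSign
  rcases hij.lt_or_gt with h1 | h1 <;> rcases hik.lt_or_gt with h2 | h2 <;>
    rcases hjk.lt_or_gt with h3 | h3 <;>
    simp only [h1, h2, h3, h1.not_gt, h2.not_gt, h3.not_gt, if_true, if_false] <;>
    first
      | (exfalso; order)
      | ring

theorem polyToRat_apply (f : MvPolynomial (Fin N) F) :
    polyToRat F N f = algebraMap (MvPolynomial (Fin N) F) _ f := rfl

theorem polyToRat_injective : Function.Injective (polyToRat F N) :=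
  IsFractionRing.injective (MvPolynomial (Fin N) F) _

theorem polyToRat_symDivDiff (i j : Fin N) (f : MvPolynomial (Fin N) F) :
    polyToRat F N (symDivDiff F i j f)
      = ratCot F i j * (polyToRat F N f - polyToRat F N (rename (Equiv.swap i j) f)) := by
  by_cases h : i = j
  · subst h; simp [symDivDiff_self]
  · have h1 := congrArg (polyToRat F N) (symDivDiff_spec i j f)
    simp only [polyToRat_apply, map_mul, map_sub, map_add] at h1 ⊢
    change (ratVar F i - ratVar F j) * _ = (ratVar F i + ratVar F j) * _ at h1
    have h2 := ratVar_sub_ne_zero (F := F) h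
    rw [ratCot, div_mul_eq_mul_div, eq_div_iff h2, ← h1, mul_comm]

theorem swap_mul_swap_cyclic {i j k : Fin N} (hik : i ≠ k) (hjk : j ≠ k) :
    Equiv.swap j k * Equiv.swap j i = Equiv.swap i j * Equiv.swap i k := by
  have h := Equiv.swap_apply_apply (Equiv.swap i j) i k
  rw [Equiv.swap_apply_left, Equiv.swap_apply_of_ne_of_ne hik.symm hjk.symm] at h
  rw [h, Equiv.swap_comm j i, inv_mul_cancel_right]

/-- The term of `∑_i (∑_j (z_i + z_j)/(z_i - z_j) (1 - K_{ij}))² + ∑_i (∑_j sign(j - i) K_{ij})²`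
with indices `i, j, k`, up to a multiple of the identity. -/
def threeBody (i j k : Fin N) (f : MvPolynomial (Fin N) F) : MvPolynomial (Fin N) F :=
  symDivDiff F i j (symDivDiff F i k f)
    + (orderSign F i j * orderSign F i k)
      • (rename (Equiv.swap i j) (rename (Equiv.swap i k) f) - f)

theorem polyToRat_threeBody {i j k : Fin N} (hik : i ≠ k) (hjk : j ≠ k)
    (f : MvPolynomial (Fin N) F) :
    polyToRat F N (threeBody i j k f)
      = ratCot F i j * (ratCot F i k * (polyToRat F N f - polyToRat F N (rename (Equiv.swap i k) f))
        - ratCot F j k * (polyToRat F N (rename (Equiv.swap i j) f)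
          - polyToRat F N (rename (Equiv.swap j k * Equiv.swap j i) f)))
      + (algebraMap F _ (orderSign F i j) * algebraMap F _ (orderSign F i k))
        * (polyToRat F N (rename (Equiv.swap i j * Equiv.swap i k) f) - polyToRat F N f) := by
  rw [threeBody, map_add, map_smul, map_sub, polyToRat_symDivDiff, polyToRat_symDivDiff,
    rename_symDivDiff, Equiv.swap_apply_left, Equiv.swap_apply_of_ne_of_ne hik.symm hjk.symm,
    polyToRat_symDivDiff, rename_rename_perm, rename_rename_perm, Algebra.smul_def, map_mul,
    Equiv.swap_comm i j]

/-- If two indices coincide, every term vanishes separately. For distinct indices, the terms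
containing one transposition cancel, and the identity and the two 3-cycles are multiplied by the
difference of the two cyclic sums, which both equal `1`. -/
theorem threeBody_perm_sum (i j k : Fin N) (f : MvPolynomial (Fin N) F) :
    threeBody i j k f + threeBody i k j f + threeBody j i k f + threeBody j k i f
      + threeBody k i j f + threeBody k j i f = 0 := by
  have hself : ∀ (a b : Fin N), threeBody a b b f = 0 := fun a b => by
    rw [threeBody, symDivDiff_symDivDiff, rename_rename_perm, Equiv.swap_mul_self]
    simp
  have hl : ∀ (a b : Fin N), threeBody a a b f = 0 := fun a b => by
    simp [threeBody, symDivDiff_self, orderSign_self]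
  have hr : ∀ (a b : Fin N), threeBody a b a f = 0 := fun a b => by
    simp [threeBody, symDivDiff_self, orderSign_self]
  by_cases hij : i = j
  · subst hij; simp [hself, hl, hr]
  by_cases hik : i = k
  · subst hik; simp [hself, hl, hr]
  by_cases hjk : j = k
  · subst hjk; simp [hself, hl, hr]
  apply polyToRat_injective
  have hc := ratCot_cyclic (F := F) hij hik hjk
  have hs := congrArg (algebraMap F (FractionRing (MvPolynomial (Fin N) F)))
    (orderSign_cyclic (F := F) hij hik hjk)
  simp only [map_add, map_zero, polyToRat_threeBody hik hjk, polyToRat_threeBody hij (Ne.symm hjk),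
    polyToRat_threeBody hjk hik, polyToRat_threeBody (Ne.symm hij) (Ne.symm hik),
    polyToRat_threeBody (Ne.symm hjk) hij, polyToRat_threeBody (Ne.symm hik) (Ne.symm hij)]
  -- All products of two transpositions are brought to one of the two 3-cycles on `i, j, k`.
  rw [swap_mul_swap_cyclic (Ne.symm hij) (Ne.symm hik), swap_mul_swap_cyclic hik hjk,
    swap_mul_swap_cyclic (Ne.symm hik) (Ne.symm hij), swap_mul_swap_cyclic hij (Ne.symm hjk)]
  generalize Equiv.swap i j * Equiv.swap i k = c₁
  generalize Equiv.swap i k * Equiv.swap i j = c₂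
  simp only [map_add, map_mul, map_one] at hs
  rw [Equiv.swap_comm j i, Equiv.swap_comm k i, Equiv.swap_comm k j]
  rw [ratCot_symm i j, ratCot_symm i k, ratCot_symm j k] at hc ⊢
  rw [orderSign_symm i j, orderSign_symm i k, orderSign_symm j k] at hs ⊢
  simp only [map_neg] at hs ⊢
  linear_combination (2 * polyToRat F N f - polyToRat F N (rename c₁ f)
    - polyToRat F N (rename c₂ f)) * (hc - hs)

theorem sum_threeBody [CharZero F] (f : MvPolynomial (Fin N) F) :
    ∑ i, ∑ j, ∑ k, threeBody i j k f = 0 := by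
  have e12 : ∀ t : Fin N → Fin N → Fin N → MvPolynomial (Fin N) F,
      ∑ i, ∑ j, ∑ k, t j i k = ∑ i, ∑ j, ∑ k, t i j k := fun t => Finset.sum_comm
  have e23 : ∀ t : Fin N → Fin N → Fin N → MvPolynomial (Fin N) F,
      ∑ i, ∑ j, ∑ k, t i k j = ∑ i, ∑ j, ∑ k, t i j k := fun t =>
    Finset.sum_congr rfl fun _ _ => Finset.sum_comm
  have h : ∑ i, ∑ j, ∑ k, (threeBody i j k f + threeBody i k j f + threeBody j i k f
      + threeBody j k i f + threeBody k i j f + threeBody k j i f) = 0 :=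
    Finset.sum_eq_zero fun i _ => Finset.sum_eq_zero fun j _ => Finset.sum_eq_zero fun k _ =>
      threeBody_perm_sum i j k f
  simp only [Finset.sum_add_distrib] at h
  rw [e23 fun i j k => threeBody i j k f, e12 fun i j k => threeBody i j k f,
    e12 fun i j k => threeBody i k j f, e23 fun i j k => threeBody i j k f,
    e23 fun i j k => threeBody j i k f, e12 fun i j k => threeBody i j k f,
    e23 fun i j k => threeBody j k i f, e12 fun i j k => threeBody i k j f,
    e23 fun i j k => threeBody i j k f] at h
  -- Each of the six index orders gives the same total sum.
  have h6 : (6 : F) • ∑ i, ∑ j, ∑ k, threeBody i j k f = 0 := by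
    rw [← h]; module
  exact (smul_eq_zero.mp h6).resolve_left (by norm_num)

/-- A joint eigenfunction of the Dunkl operators is an eigenfunction of `calogero`. -/
theorem calogero_eq_of_dunkl_eq [CharZero F] (α : F) (c : Fin N → F)
    (f : MvPolynomial (Fin N) F) (hf : ∀ i, dunkl α i f = c i • f) :
    calogero N α f = (∑ i : Fin N, ((2 * c i + ((N : F) - 1)) ^ 2
      - ((N : F) - 1 - 2 * ((i : ℕ) : F)) ^ 2)) • f := by
  have hc : ∀ i, covariantDunkl α i f + signedSwaps F i f = (2 * c i + ((N : F) - 1)) • f := by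
    intro i
    have h := two_smul_dunkl α i f
    rw [hf, smul_smul] at h
    rw [add_smul, h]; abel
  have hsq : ∀ i, covariantDunkl α i (covariantDunkl α i f)
      + (covariantDunkl α i (signedSwaps F i f) + signedSwaps F i (covariantDunkl α i f))
      + signedSwaps F i (signedSwaps F i f) = (2 * c i + ((N : F) - 1)) ^ 2 • f := by
    intro i
    have h1 := congrArg (covariantDunkl α i) (hc i)
    have h2 := congrArg (signedSwaps F i) (hc i)
    rw [map_add, map_smul] at h1 h2
    rw [pow_two, mul_smul]
    rw [← hc i, smul_add, ← h1, ← h2]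
    abel
  have hR : ∑ i, signedSwaps F i (signedSwaps F i f) = ∑ i, ∑ j, ∑ k,
      (orderSign F i j * orderSign F i k)
        • rename (Equiv.swap i j) (rename (Equiv.swap i k) f) := by
    simp only [signedSwaps_apply, map_sum, map_smul, Finset.smul_sum, smul_smul]
    refine Finset.sum_congr rfl fun i _ => ?_
    rw [Finset.sum_comm]
    exact Finset.sum_congr rfl fun j _ => Finset.sum_congr rfl fun k _ => by rw [mul_comm]
  have hT := sum_threeBody f
  simp only [threeBody, smul_sub, Finset.sum_add_distrib, Finset.sum_sub_distrib] at hT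
  rw [← hR] at hT
  have hS : ∑ i : Fin N, ∑ j, ∑ k, (orderSign F i j * orderSign F i k) • f
      = ∑ i : Fin N, ((N : F) - 1 - 2 * ((i : ℕ) : F)) ^ 2 • f := by
    refine Finset.sum_congr rfl fun i _ => ?_
    simp only [← Finset.sum_smul, ← Finset.mul_sum, ← Finset.sum_mul, sum_orderSign, pow_two]
  have hsum := Finset.sum_congr (rfl : (Finset.univ : Finset (Fin N)) = _) fun i _ => hsq i
  rw [Finset.sum_add_distrib, Finset.sum_add_distrib, sum_covariantDunkl_signedSwaps,
    sum_covariantDunkl_sq, add_zero] at hsum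
  rw [Finset.sum_smul]
  simp only [sub_smul, Finset.sum_sub_distrib]
  rw [← hsum, ← hS]
  -- `hT` exchanges the triple sum of `symDivDiff` left over from the covariant squares for the
  -- signed exchanges and the scalar `∑ (N - 1 - 2 i)²`.
  linear_combination -hT

/-! ### Partial sums of Dunkl operators -/

/-- The sum `D_1 + ⋯ + D_m` only involves the exchanges between `{1, …, m}` and its complement. -/
theorem two_smul_sum_dunkl [CharZero F] (α : F) (n : ℕ) (f : MvPolynomial (Fin N) F) :
    (2 : F) • ∑ i with (i : Fin N).val < n, dunkl α i f
      = ∑ i, (if i.val < n then (2 * α) • euler F i f - ((N : F) - 1) • f else 0)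
        + ∑ i, ∑ j, if i.val < n ∧ ¬ j.val < n
          then symDivDiff F i j f + rename (Equiv.swap i j) f else 0 := by
  have key : ∀ i : Fin N, i.val < n → (2 : F) • dunkl α i f
      = ((2 * α) • euler F i f - ((N : F) - 1) • f)
        + (∑ j with (j : Fin N).val < n,
            (symDivDiff F i j f + orderSign F i j • rename (Equiv.swap i j) f)
          + ∑ j with ¬ (j : Fin N).val < n,
            (symDivDiff F i j f + rename (Equiv.swap i j) f)) := by
    intro i hi
    have h1 : ∑ j with ¬ (j : Fin N).val < n, (symDivDiff F i j f + rename (Equiv.swap i j) f)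
        = ∑ j with ¬ (j : Fin N).val < n,
          (symDivDiff F i j f + orderSign F i j • rename (Equiv.swap i j) f) := by
      refine Finset.sum_congr rfl fun j hj => ?_
      have hj' : ¬ j.val < n := (Finset.mem_filter.mp hj).2
      -- Indices inside the initial segment precede those outside it, so the sign is `1` and no
      -- longer refers to the order within either set.
      have hij : i < j := Fin.lt_def.mpr (by omega)
      simp [orderSign, hij]
    rw [h1, Finset.sum_filter_add_sum_filter_not, two_smul_dunkl, covariantDunkl_apply,
      signedSwaps_apply, Finset.sum_add_distrib]
    abel
  have h0 : ∑ i with (i : Fin N).val < n, ∑ j with (j : Fin N).val < n,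
      (symDivDiff F i j f + orderSign F i j • rename (Equiv.swap i j) f) = 0 := by
    apply sum_sum_eq_zero_of_antisymm (F := F)
    intro i j
    rw [symDivDiff_symm i j, orderSign_symm i j, Equiv.swap_comm j i, LinearMap.neg_apply,
      neg_smul, neg_add]
  rw [Finset.smul_sum, Finset.sum_congr rfl fun i hi => key i (Finset.mem_filter.mp hi).2,
    Finset.sum_add_distrib, Finset.sum_add_distrib, h0, zero_add, Finset.sum_filter,
    Finset.sum_filter]
  congr 1
  refine Finset.sum_congr rfl fun i _ => ?_
  by_cases hi : i.val < n
  · simp only [hi, if_true, true_and, Finset.sum_filter]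
  · simp [hi]

theorem rename_sum_dunkl [CharZero F] (α : F) (n : ℕ) (σ : Equiv.Perm (Fin N))
    (hσ : ∀ i, (σ i).val < n ↔ i.val < n) (f : MvPolynomial (Fin N) F) :
    rename σ (∑ i with (i : Fin N).val < n, dunkl α i f)
      = ∑ i with (i : Fin N).val < n, dunkl α i (rename σ f) := by
  apply smul_right_injective _ (two_ne_zero' F)
  change (2 : F) • _ = (2 : F) • _
  rw [← map_smul, two_smul_sum_dunkl, two_smul_sum_dunkl,
    ← Equiv.sum_comp σ fun i : Fin N => if i.val < n
      then (2 * α) • euler F i (rename σ f) - ((N : F) - 1) • rename σ f else 0,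
    ← Equiv.sum_comp σ fun i : Fin N => ∑ j : Fin N, if i.val < n ∧ ¬ j.val < n
      then symDivDiff F i j (rename σ f) + rename (Equiv.swap i j) (rename σ f) else 0,
    map_add, map_sum, map_sum]
  congr 1
  · refine Finset.sum_congr rfl fun i _ => ?_
    simp only [hσ, apply_ite (rename (R := F) σ), map_sub, map_smul, map_zero, rename_euler]
  · refine Finset.sum_congr rfl fun i _ => ?_
    rw [map_sum]
    refine (Finset.sum_congr rfl fun j _ => ?_).trans (Equiv.sum_comp σ _)
    simp only [hσ, apply_ite (rename (R := F) σ), map_add, map_zero, rename_symDivDiff,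
      rename_rename_perm, Equiv.swap_apply_apply, inv_mul_cancel_right]

/-! ### The exchange form of the Hamiltonian -/

theorem sum_sum_eq_sum_Ioi {V : Type*} [AddCommMonoid V] (t : Fin N → Fin N → V)
    (h : ∀ i, t i i = 0) :
    ∑ i, ∑ j, t i j = ∑ i, ∑ j ∈ Finset.Ioi i, (t i j + t j i) := by
  have h1 : ∀ i j, t i j = (if i < j then t i j else 0) + (if j < i then t i j else 0) := by
    intro i j
    rcases lt_trichotomy i j with hl | hl | hl
    · simp [hl, hl.not_gt]
    · subst hl; simp [h]
    · simp [hl, hl.not_gt]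
  have h2 : ∀ (i : Fin N) (g : Fin N → V),
      ∑ j ∈ Finset.Ioi i, g j = ∑ j, if i < j then g j else 0 := by
    intro i g
    rw [← Finset.sum_filter]; congr 1; ext; simp
  simp only [h2]
  conv_lhs => enter [2, i, 2, j]; rw [h1 i j]
  simp only [Finset.sum_add_distrib]
  rw [Finset.sum_comm (f := fun i j => if j < i then t i j else 0), ← Finset.sum_add_distrib]
  refine Finset.sum_congr rfl fun i _ => ?_
  rw [← Finset.sum_add_distrib]
  refine Finset.sum_congr rfl fun j _ => ?_
  split_ifs <;> simp

/-- By the Leibniz rule: `z_i ∂_i` sends `(z_i + z_j)/(z_i - z_j)` to `-2 z_i z_j/(z_i - z_j)²`, and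
the pair `(j, i)` doubles this. In the remaining terms the exchanged derivatives cancel, since `z_i
∂_i K_{ij} = K_{ij} z_j ∂_j`. -/
theorem polyToRat_euler_symDivDiff {i j : Fin N} (h : i ≠ j) (f : MvPolynomial (Fin N) F) :
    polyToRat F N (euler F i (symDivDiff F i j f) + symDivDiff F i j (euler F i f)
        + (euler F j (symDivDiff F j i f) + symDivDiff F j i (euler F j f)))
      = 2 * (ratCot F i j * polyToRat F N ((euler F i - euler F j) f))
        - 4 * (ratVar F i * ratVar F j / (ratVar F i - ratVar F j) ^ 2
          * polyToRat F N (f - rename (Equiv.swap i j) f)) := by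
  have h1 := congrArg (fun p => polyToRat F N (euler F i p)) (symDivDiff_spec i j f)
  have h2 := congrArg (fun p => polyToRat F N (euler F j p)) (symDivDiff_spec i j f)
  have h3 := polyToRat_symDivDiff i j f
  have h4 := polyToRat_symDivDiff i j (euler F i f)
  have h5 := polyToRat_symDivDiff i j (euler F j f)
  rw [rename_euler] at h4 h5
  rw [Equiv.swap_apply_left] at h4
  rw [Equiv.swap_apply_right] at h5
  have hne := ratVar_sub_ne_zero (F := F) h
  rw [ratCot, div_mul_eq_mul_div, eq_div_iff hne] at h3 h4 h5
  simp only [euler_mul, map_sub, map_add, map_mul, map_zero, euler_X_self, euler_X_of_ne h,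
    euler_X_of_ne h.symm, polyToRat_apply] at h1 h2 h3 h4 h5
  simp only [symDivDiff_symm i j, LinearMap.neg_apply, LinearMap.sub_apply, map_add, map_sub,
    map_neg, polyToRat_apply, ratCot]
  simp only [← ratVar.eq_1] at h1 h2
  apply mul_left_cancel₀ (pow_ne_zero 2 hne)
  rw [mul_sub, show ∀ x y : FractionRing (MvPolynomial (Fin N) F),
    (ratVar F i - ratVar F j) ^ 2 * (2 * ((ratVar F i + ratVar F j) / (ratVar F i - ratVar F j) * x))
      - (ratVar F i - ratVar F j) ^ 2
        * (4 * (ratVar F i * ratVar F j / (ratVar F i - ratVar F j) ^ 2 * y))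
      = 2 * (ratVar F i - ratVar F j) * (ratVar F i + ratVar F j) * x
        - 4 * (ratVar F i * ratVar F j) * y from fun x y => by field_simp]
  linear_combination (ratVar F i - ratVar F j) * (h1 - h2) + (ratVar F i - ratVar F j) * (h4 - h5)
    - (ratVar F i + ratVar F j) * h3

/-- In terms of `calogero`, the exchange form of the Hamiltonian. -/
theorem polyToRat_calogero {α : F} (hα : α ≠ 0) (f : MvPolynomial (Fin N) F) :
    polyToRat F N (calogero N α f) = (4 * α ^ 2) •
      ((∑ i, polyToRat F N (euler F i (euler F i f)))
        + α⁻¹ • (∑ i, ∑ j ∈ Finset.Ioi i, ratCot F i j * polyToRat F N ((euler F i - euler F j) f))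
        - (2 * α⁻¹) • (∑ i, ∑ j ∈ Finset.Ioi i,
          ratVar F i * ratVar F j / (ratVar F i - ratVar F j) ^ 2
            * polyToRat F N (f - rename (Equiv.swap i j) f))) := by
  rw [calogero_apply, sum_sum_eq_sum_Ioi _ fun i => by simp [symDivDiff_self]]
  have h : ∀ i : Fin N, ∀ j ∈ Finset.Ioi i, _ := fun i j hj =>
    polyToRat_euler_symDivDiff (Finset.mem_Ioi.mp hj).ne f
  rw [map_add, map_smul, map_smul, map_sum, map_sum]
  simp only [map_sum]
  rw [Finset.sum_congr rfl fun i _ => Finset.sum_congr rfl (h i)]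
  simp only [Finset.sum_sub_distrib, ← Finset.mul_sum]
  generalize ∑ i, ∑ j ∈ Finset.Ioi i, ratCot F i j * polyToRat F N ((euler F i - euler F j) f) = a
  generalize ∑ i, ∑ j ∈ Finset.Ioi i, ratVar F i * ratVar F j / (ratVar F i - ratVar F j) ^ 2
            * polyToRat F N (f - rename (Equiv.swap i j) f) = b
  rw [show (2 : FractionRing (MvPolynomial (Fin N) F)) * a = (2 : F) • a by
      rw [ofNat_smul_eq_nsmul, nsmul_eq_mul, Nat.cast_ofNat],
    show (4 : FractionRing (MvPolynomial (Fin N) F)) * b = (4 : F) • b by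
      rw [ofNat_smul_eq_nsmul, nsmul_eq_mul, Nat.cast_ofNat],
    smul_sub, smul_sub, smul_add, smul_smul, smul_smul, smul_smul, smul_smul,
    show 4 * α ^ 2 * α⁻¹ = 2 * α * 2 by field_simp; norm_num,
    show 4 * α ^ 2 * (2 * α⁻¹) = 2 * α * 4 by field_simp]
  abel

end Bosonic

/-! ### Exchanges and monomials in the anticommuting variables -/

section Fermionic

/-- The operator `1 - v d⌋` on the exterior algebra is the algebra endomorphism induced by
`m ↦ m - d(m) v`. -/
theorem one_sub_mulLeft_contractLeft {R M : Type*} [CommRing R] [AddCommGroup M] [Module R M]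
    (v : M) (d : Module.Dual R M) (x : ExteriorAlgebra R M) :
    x - ExteriorAlgebra.ι R v
        * CliffordAlgebra.contractLeft (Q := (0 : QuadraticForm R M)) d x
      = ExteriorAlgebra.map (LinearMap.id - d.smulRight v) x := by
  induction x using CliffordAlgebra.left_induction with
  | algebraMap r =>
    rw [CliffordAlgebra.contractLeft_algebraMap, mul_zero, sub_zero]
    exact (AlgHom.commutes _ r).symm
  | add x y hx hy => rw [map_add, map_add, mul_add, ← hx, ← hy]; abel
  | ι_mul x m hx =>
    rw [CliffordAlgebra.contractLeft_ι_mul]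
    change ExteriorAlgebra.ι R m * x - _ = ExteriorAlgebra.map _ (ExteriorAlgebra.ι R m * x)
    rw [map_mul, ExteriorAlgebra.map_apply_ι, ← hx]
    simp only [LinearMap.sub_apply, LinearMap.id_apply, LinearMap.smulRight_apply, map_sub, map_smul]
    generalize CliffordAlgebra.contractLeft (Q := (0 : QuadraticForm R M)) d x = y
    change ExteriorAlgebra.ι R m * x
      - ExteriorAlgebra.ι R v * (d m • x - ExteriorAlgebra.ι R m * y) = _
    have h1 := ExteriorAlgebra.ι_add_mul_swap (R := R) v m
    have h2 := ExteriorAlgebra.ι_sq_zero (R := R) v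
    generalize ExteriorAlgebra.ι R v = V at *
    generalize ExteriorAlgebra.ι R m = W at *
    have h3 : V * W = -(W * V) := eq_neg_of_add_eq_zero_left h1
    rw [mul_sub, sub_mul, mul_sub, mul_sub, ← mul_assoc V, h3, smul_mul_assoc, smul_mul_assoc,
      ← mul_assoc V V, h2, zero_mul, smul_zero, mul_smul_comm, neg_mul, mul_assoc]
    abel

variable (F : Type*) [Field F] {N : ℕ}

theorem one_sub_gen_sub_genDeriv_sub (x y : Fin N ⊕ Fin N) (g : Grassmann F N) :
    (1 - LinearMap.mulLeft F (gen F x - gen F y) * (genDeriv F x - genDeriv F y)) g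
      = ExteriorAlgebra.map (LinearMap.id - (Finsupp.lapply x - Finsupp.lapply y : Module.Dual F (Fin N ⊕ Fin N →₀ F)).smulRight
          (Finsupp.single x (1 : F) - Finsupp.single y 1)) g := by
  rw [← one_sub_mulLeft_contractLeft, map_sub, map_sub]
  rfl

/-- By `one_sub_mulLeft_contractLeft` each factor is an algebra endomorphism induced by the
reflection along `φ_i - φ_j` or `θ_i - θ_j`, so it suffices to compare both sides on generators. -/
theorem kappaPhi_mul_kappaTheta {i j : Fin N} (hij : i ≠ j) :
    kappaPhi F i j * kappaTheta F i j = grassmannPerm F (Equiv.swap i j) := by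
  refine LinearMap.ext fun g => ?_
  rw [Module.End.mul_apply, kappaPhi, kappaTheta, one_sub_gen_sub_genDeriv_sub,
    one_sub_gen_sub_genDeriv_sub, ← AlgHom.comp_apply, ExteriorAlgebra.map_comp_map]
  refine congrArg (fun l => ExteriorAlgebra.map l g) ?_
  refine Finsupp.lhom_ext' fun x => LinearMap.ext_ring ?_
  rcases x with x | x
  · by_cases h1 : x = i
    · subst h1; simp [hij.symm]
    · by_cases h2 : x = j
      · subst h2; simp [hij]
      · simp [h1, h2, Ne.symm h1, Ne.symm h2, Equiv.swap_apply_of_ne_of_ne]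
  · by_cases h1 : x = i
    · subst h1; simp [hij.symm]
    · by_cases h2 : x = j
      · subst h2; simp [hij]
      · simp [h1, h2, Ne.symm h1, Ne.symm h2, Equiv.swap_apply_of_ne_of_ne]

theorem grassmannPerm_mul (σ τ : Equiv.Perm (Fin N)) :
    grassmannPerm F (σ * τ) = grassmannPerm F σ ∘ₗ grassmannPerm F τ := by
  refine LinearMap.ext fun g => ?_
  simp only [grassmannPerm, LinearMap.comp_apply, AlgHom.toLinearMap_apply, ← AlgHom.comp_apply,
    ExteriorAlgebra.map_comp_map, ← Finsupp.lmapDomain_comp]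
  rw [Sum.map_comp_map]
  rfl

/-- The product of the generators in a word. -/
def wordProd (w : List (Fin N ⊕ Fin N)) : Grassmann F N := (w.map (gen F)).prod

theorem grassmannPerm_wordProd (σ : Equiv.Perm (Fin N)) (w : List (Fin N ⊕ Fin N)) :
    grassmannPerm F σ (wordProd F w) = wordProd F (w.map (Sum.map σ σ)) := by
  simp only [grassmannPerm, wordProd, AlgHom.toLinearMap_apply, map_list_prod, List.map_map]
  congr 2
  funext x
  simp [gen, ExteriorAlgebra.map_apply_ι]

theorem gen_mul_gen (x y : Fin N ⊕ Fin N) : gen F x * gen F y = -(gen F y * gen F x) :=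
  eq_neg_of_add_eq_zero_left (ExteriorAlgebra.ι_add_mul_swap _ _)

theorem wordProd_perm {u w : List (Fin N ⊕ Fin N)} (h : u.Perm w) :
    ∃ c : F, c ≠ 0 ∧ wordProd F u = c • wordProd F w := by
  induction h with
  | nil => exact ⟨1, one_ne_zero, by simp⟩
  | cons x _ ih =>
    obtain ⟨c, hc, h⟩ := ih
    refine ⟨c, hc, ?_⟩
    simp only [wordProd, List.map_cons, List.prod_cons] at h ⊢
    rw [h, mul_smul_comm]
  | swap x y l =>
    refine ⟨-1, neg_ne_zero.mpr one_ne_zero, ?_⟩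
    simp only [wordProd, List.map_cons, List.prod_cons]
    rw [← mul_assoc, gen_mul_gen, neg_mul, mul_assoc, neg_one_smul]
  | trans _ _ ih1 ih2 =>
    obtain ⟨c, hc, h⟩ := ih1
    obtain ⟨d, hd, h'⟩ := ih2
    exact ⟨c * d, mul_ne_zero hc hd, by rw [h, h', smul_smul]⟩

theorem genDeriv_gen_mul (x y : Fin N ⊕ Fin N) (g : Grassmann F N) :
    genDeriv F x (gen F y * g)
      = (if y = x then (1 : F) else 0) • g - gen F y * genDeriv F x g := by
  have h := CliffordAlgebra.contractLeft_ι_mul (Q := (0 : QuadraticForm F (Fin N ⊕ Fin N →₀ F)))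
    (d := (Finsupp.lapply x : Module.Dual F (Fin N ⊕ Fin N →₀ F))) (Finsupp.single y 1) g
  rw [Finsupp.lapply_apply, Finsupp.single_apply] at h
  exact h

theorem genDeriv_wordProd_of_notMem {x : Fin N ⊕ Fin N} {u : List (Fin N ⊕ Fin N)} (h : x ∉ u) :
    genDeriv F x (wordProd F u) = 0 := by
  induction u with
  | nil => exact CliffordAlgebra.contractLeft_one (Q := (0 : QuadraticForm F (Fin N ⊕ Fin N →₀ F))) _
  | cons y u ih =>
    rw [List.mem_cons, not_or] at h
    have := ih h.2
    simp only [wordProd, List.map_cons, List.prod_cons] at this ⊢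
    rw [genDeriv_gen_mul, this, if_neg (Ne.symm h.1), zero_smul, mul_zero, sub_zero]

theorem genDeriv_wordProd_cons {x : Fin N ⊕ Fin N} {u : List (Fin N ⊕ Fin N)} (h : x ∉ u) :
    genDeriv F x (wordProd F (x :: u)) = wordProd F u := by
  have := genDeriv_wordProd_of_notMem F h
  simp only [wordProd, List.map_cons, List.prod_cons] at this ⊢
  rw [genDeriv_gen_mul, this, if_pos rfl, one_smul, mul_zero, sub_zero]

/-- The product of the derivatives in a word, the first letter acting first. -/
def wordDeriv (w : List (Fin N ⊕ Fin N)) : Module.End F (Grassmann F N) :=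
  (w.map (genDeriv F)).reverse.prod

theorem wordDeriv_cons (x : Fin N ⊕ Fin N) (w : List (Fin N ⊕ Fin N)) (g : Grassmann F N) :
    wordDeriv F (x :: w) g = wordDeriv F w (genDeriv F x g) := by
  simp [wordDeriv, Module.End.mul_apply]

theorem wordDeriv_wordProd_self {w : List (Fin N ⊕ Fin N)} (h : w.Nodup) :
    wordDeriv F w (wordProd F w) = 1 := by
  induction w with
  | nil => simp [wordDeriv, wordProd]
  | cons x w ih =>
    rw [List.nodup_cons] at h
    rw [wordDeriv_cons, genDeriv_wordProd_cons F h.1, ih h.2]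

/-- Each derivative must find its own generator in `u` and removes it; a generator left at the end
would give constant term zero. -/
theorem perm_of_wordDeriv_wordProd_ne_zero {w u : List (Fin N ⊕ Fin N)} (hu : u.Nodup)
    (h : ExteriorAlgebra.algebraMapInv (wordDeriv F w (wordProd F u)) ≠ 0) : u.Perm w := by
  induction w generalizing u with
  | nil =>
    cases u with
    | nil => exact List.Perm.nil
    | cons y u =>
      exfalso; apply h
      simp [wordDeriv, wordProd, gen, ExteriorAlgebra.algebraMapInv]
  | cons x w ih =>
    rw [wordDeriv_cons] at h
    by_cases hx : x ∈ u
    · obtain ⟨s, t, rfl⟩ := List.append_of_mem hx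
      have hp : (s ++ x :: t).Perm (x :: (s ++ t)) := List.perm_middle
      obtain ⟨c, hc, hcu⟩ := wordProd_perm F hp
      have hn := List.nodup_cons.mp (hp.nodup_iff.mp hu)
      rw [hcu, map_smul, genDeriv_wordProd_cons F hn.1, map_smul, map_smul] at h
      exact hp.trans ((ih hn.2 (right_ne_zero_of_smul h)).cons x)
    · rw [genDeriv_wordProd_of_notMem F hx, map_zero, map_zero] at h
      exact absurd rfl h

theorem fermionProj_apply (m : Fin 3 → ℕ) (g : Grassmann F N) :
    fermionProj F N m g = ExteriorAlgebra.algebraMapInv (wordDeriv F (fermionWord N m) g)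
      • wordProd F (fermionWord N m) := rfl

/-! ### Fermionic sectors and block-preserving permutations -/

/-- The generators occurring at each position of `[φ;θ]_M`. -/
def blockType (N : ℕ) (m : Fin 3 → ℕ) (i : Fin N) : Bool × Bool :=
  (decide (i.val < partialSum m 1),
    decide (i.val < partialSum m 0 ∨ partialSum m 1 ≤ i.val ∧ i.val < partialSum m 2))

theorem mem_fermionWord (m : Fin 3 → ℕ) (x : Fin N ⊕ Fin N) :
    x ∈ fermionWord N m ↔ Sum.elim (fun i => (blockType N m i).1) (fun i => (blockType N m i).2) x := by
  have h0 := partialSum_zero m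
  have h1 := partialSum_one m
  rcases x with i | i
  · simp [fermionWord, blockType]; omega
  · simp [fermionWord, blockType]

theorem nodup_fermionWord (m : Fin 3 → ℕ) : (fermionWord N m).Nodup := by
  have h0 := partialSum_zero m
  have h1 := partialSum_one m
  have hf := List.nodup_finRange N
  unfold fermionWord
  refine List.Nodup.append (List.Nodup.append ?_ ((hf.filter _).map Sum.inl_injective) ?_)
    ((hf.filter _).map Sum.inr_injective) ?_
  · rw [List.nodup_flatMap]
    refine ⟨fun i _ => by simp, ?_⟩
    refine (hf.filter _).imp ?_
    intro i j hij
    simp [Function.onFun, List.disjoint_left, hij]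
  · rw [List.disjoint_left]; rintro (i | i) <;> simp
    omega
  · rw [List.disjoint_left]; rintro (i | i) <;> simp
    omega

/-- Words without repeated letters are rearrangements of each other exactly when they have the same
letters, and `blockType` records the letters position by position. -/
theorem map_fermionWord_perm_iff (m m' : Fin 3 → ℕ) (σ : Equiv.Perm (Fin N)) :
    ((fermionWord N m).map (Sum.map σ σ)).Perm (fermionWord N m')
      ↔ blockType N m' ∘ σ = blockType N m := by
  have hinj : Function.Injective (Sum.map σ σ) := Sum.map_injective.mpr ⟨σ.injective, σ.injective⟩
  rw [List.perm_ext_iff_of_nodup ((nodup_fermionWord m).map hinj) (nodup_fermionWord m')]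
  have hs : ∀ x, Sum.map σ σ x ∈ (fermionWord N m).map (Sum.map σ σ) ↔ x ∈ fermionWord N m :=
    fun x => List.mem_map_of_injective hinj
  have hsurj : Function.Surjective (Sum.map σ σ) := Sum.map_surjective.mpr ⟨σ.surjective, σ.surjective⟩
  rw [hsurj.forall]
  simp only [hs, mem_fermionWord, Sum.forall, Sum.map_inl, Sum.map_inr, Sum.elim_inl, Sum.elim_inr]
  refine ⟨fun h => funext fun i => Prod.ext (Bool.eq_iff_iff.mpr (h.1 i).symm)
    (Bool.eq_iff_iff.mpr (h.2 i).symm), fun h => ⟨fun i => ?_, fun i => ?_⟩⟩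
  · rw [← congrFun h i]; rfl
  · rw [← congrFun h i]; rfl

theorem card_fin_subtype {p : Fin N → Prop} [DecidablePred p] {a b : ℕ} (hb : b ≤ N)
    (hp : ∀ i : Fin N, p i ↔ a ≤ i.val ∧ i.val < b) : Fintype.card {i // p i} = b - a := by
  rw [Fintype.card_subtype, ← Nat.card_Ico, ← Finset.card_map Fin.valEmbedding]
  congr 1
  ext n
  simp only [Finset.mem_map, Finset.mem_filter, Finset.mem_univ, true_and, hp, Fin.valEmbedding_apply,
    Finset.mem_Ico]
  exact ⟨fun ⟨i, hi, hn⟩ => hn ▸ hi, fun h => ⟨⟨n, h.2.trans_le hb⟩, h, rfl⟩⟩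

theorem card_blockType_fiber {m : Fin 3 → ℕ} (hm : partialSum m 2 ≤ N) (b : Bool × Bool) :
    Fintype.card {i : Fin N // blockType N m i = b}
      = match b with
        | (true, true) => m 0
        | (true, false) => m 1
        | (false, true) => m 2
        | (false, false) => N - partialSum m 2 := by
  have h0 := partialSum_zero m
  have h1 := partialSum_one m
  have h2 := partialSum_two m
  match b with
  | (true, true) =>
    rw [card_fin_subtype (a := 0) (b := m 0) (by omega)]
    · rfl
    · intro i; simp [blockType]; omega
  | (true, false) =>
    rw [card_fin_subtype (a := m 0) (b := m 0 + m 1) (by omega)]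
    · simp
    · intro i; simp [blockType]; omega
  | (false, true) =>
    rw [card_fin_subtype (a := m 0 + m 1) (b := m 0 + m 1 + m 2) (by omega)]
    · simp
    · intro i; simp [blockType]; omega
  | (false, false) =>
    rw [card_fin_subtype (a := partialSum m 2) (b := N) le_rfl]
    intro i
    have := i.isLt
    simp [blockType]; omega

/-- These permutations form the stabilizer of `blockType N m`; it is the product of the symmetric
groups of the four fibres. -/
theorem card_blockType {m : Fin 3 → ℕ} (hm : partialSum m 2 ≤ N) :
    (Finset.univ.filter fun σ : Equiv.Perm (Fin N) => blockType N m ∘ σ = blockType N m).card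
      = youngCard N m := by
  rw [← Fintype.card_subtype, DomMulAct.stabilizer_card, Fintype.prod_prod_type,
    Fintype.prod_bool, Fintype.prod_bool, Fintype.prod_bool]
  simp only [card_blockType_fiber hm]
  rw [youngCard]
  ring

/-- The fibre sizes of `blockType` are invariant under permutations and determine the sector. -/
theorem eq_of_blockType_comp_eq {m m' : Fin 3 → ℕ} (hm : partialSum m 2 ≤ N)
    (hm' : partialSum m' 2 ≤ N) (σ : Equiv.Perm (Fin N))
    (h : blockType N m' ∘ σ = blockType N m) : m = m' := by
  have hc : ∀ b, Fintype.card {i : Fin N // blockType N m i = b}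
      = Fintype.card {i : Fin N // blockType N m' i = b} := fun b =>
    Fintype.card_congr (σ.subtypeEquiv fun i => by rw [← h]; rfl)
  simp only [card_blockType_fiber hm, card_blockType_fiber hm'] at hc
  funext k
  fin_cases k
  · exact hc (true, true)
  · exact hc (true, false)
  · exact hc (false, true)

theorem lt_partialSum_iff_of_blockType {m : Fin 3 → ℕ} {i j : Fin N}
    (h : blockType N m i = blockType N m j) (k : Fin 3) :
    i.val < partialSum m k ↔ j.val < partialSum m k := by
  have h0 := partialSum_zero m
  have h1 := partialSum_one m
  have h2 := partialSum_two m
  simp only [blockType, Prod.mk.injEq, decide_eq_decide] at h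
  fin_cases k <;> simp only [Fin.zero_eta, Fin.mk_one, Fin.reduceFinMk] <;> omega

/-- The reordering sign does not matter: the projector returns the permuted monomial itself, sign
included. -/
theorem fermionProj_grassmannPerm (m m' : Fin 3 → ℕ) (σ : Equiv.Perm (Fin N)) :
    fermionProj F N m' (grassmannPerm F σ (fermionMonomial F N m))
      = if blockType N m' ∘ σ = blockType N m then grassmannPerm F σ (fermionMonomial F N m)
        else 0 := by
  rw [fermionProj_apply, show fermionMonomial F N m = wordProd F (fermionWord N m) from rfl,
    grassmannPerm_wordProd]
  split_ifs with h
  · obtain ⟨c, _, hc⟩ := wordProd_perm F ((map_fermionWord_perm_iff m m' σ).mpr h)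
    rw [hc, map_smul, wordDeriv_wordProd_self F (nodup_fermionWord m'), map_smul, map_one,
      smul_eq_mul, mul_one]
  · by_contra h0
    refine h ((map_fermionWord_perm_iff m m' σ).mp
      (perm_of_wordDeriv_wordProd_ne_zero F ((nodup_fermionWord m).map
        (Sum.map_injective.mpr ⟨σ.injective, σ.injective⟩)) (left_ne_zero_of_smul h0)))

end Fermionic

/-! ### Stable sorting and the eigenvalues -/

section Compositions

variable {N : ℕ}

/-- The stable permutation sorting a composition into weakly decreasing order. -/
def stableSort (η : Fin N → ℕ) : Equiv.Perm (Fin N) :=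
  Tuple.sort fun k => OrderDual.toDual (η k)

theorem sortDesc_apply (η : Fin N → ℕ) (p : Fin N) : sortDesc η p = η (stableSort η p) := rfl

/-- The two alternatives are the two sets counted in `etaHat`: ties go to the smaller position. -/
theorem stableSort_lt_iff (η : Fin N → ℕ) (p q : Fin N) :
    q < p ↔ (stableSort η q < stableSort η p ∧ η (stableSort η p) ≤ η (stableSort η q))
      ∨ (stableSort η p < stableSort η q ∧ η (stableSort η p) < η (stableSort η q)) := by
  have hs := (Tuple.eq_sort_iff (f := fun k => OrderDual.toDual (η k))
    (σ := stableSort η)).mp rfl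
  have key : ∀ a b : Fin N, a < b →
      (stableSort η a < stableSort η b ∧ η (stableSort η b) ≤ η (stableSort η a))
      ∨ (stableSort η b < stableSort η a ∧ η (stableSort η b) < η (stableSort η a)) := by
    intro a b hab
    have h1 : η (stableSort η b) ≤ η (stableSort η a) := sortDesc_antitone η hab.le
    rcases h1.lt_or_eq with h2 | h2
    · rcases lt_trichotomy (stableSort η a) (stableSort η b) with h3 | h3 | h3
      · exact Or.inl ⟨h3, h1⟩
      · exact absurd ((stableSort η).injective h3) hab.ne
      · exact Or.inr ⟨h3, h2⟩
    · exact Or.inl ⟨hs.2 a b hab (congrArg _ h2.symm), h1⟩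
  refine ⟨key q p, fun h => ?_⟩
  rcases lt_trichotomy q p with h1 | h1 | h1
  · exact h1
  · subst h1; simp at h
  · exfalso
    rcases key p q h1 with h2 | h2 <;> rcases h with h3 | h3 <;> omega

/-- The eigenvalue `η̂` at the `p`-th largest entry of `η`. -/
theorem etaHat_stableSort {F : Type*} [Field F] (α : F) (η : Fin N → ℕ) (p : Fin N) :
    etaHat α η (stableSort η p) = α * (sortDesc η p : F) - ((p : ℕ) : F) := by
  rw [etaHat, sortDesc_apply]
  congr 2
  rw [← Finset.card_union_of_disjoint, ← Finset.filter_or, ← Fin.card_Iio p,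
    ← Finset.card_map (stableSort η).toEmbedding (s := Finset.Iio p)]
  · congr 1
    ext j
    obtain ⟨q, rfl⟩ := (stableSort η).surjective j
    simp only [Finset.mem_filter, Finset.mem_univ, true_and, Finset.mem_map_equiv,
      Equiv.symm_apply_apply, Finset.mem_Iio, stableSort_lt_iff η p q]
  · rw [Finset.disjoint_filter]
    intro j _ h1 h2
    exact absurd h1.1 h2.1.not_gt

theorem sortDesc_eq_comp {η : Fin N → ℕ} {σ : Equiv.Perm (Fin N)} (h : Antitone (η ∘ σ)) :
    sortDesc η = η ∘ σ :=
  ((Tuple.comp_sort_eq_comp_iff_monotone (f := fun k => OrderDual.toDual (η k)) (σ := σ)).mpr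
    fun _ _ hab => h hab).symm

theorem sortDesc_comp_perm (η : Fin N → ℕ) (σ : Equiv.Perm (Fin N)) :
    sortDesc (η ∘ σ) = sortDesc η := by
  have h : Antitone ((η ∘ σ) ∘ (stableSort η).trans σ.symm) := by
    intro a b hab
    simpa [sortDesc_apply] using sortDesc_antitone η hab
  rw [sortDesc_eq_comp h]
  funext p
  simp [sortDesc_apply]

/-- Adding `1` to the first `n` entries is compatible with the stable sorting. -/
theorem sortDesc_add_indicator (η : Fin N → ℕ) (n : ℕ) (p : Fin N) :
    sortDesc (fun i => η i + if i.val < n then 1 else 0) p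
      = sortDesc η p + if (stableSort η p).val < n then 1 else 0 := by
  rw [sortDesc_eq_comp (σ := stableSort η)]
  · rfl
  · intro a b hab
    rcases hab.eq_or_lt with rfl | hab
    · exact le_rfl
    · simp only [Function.comp_apply]
      -- Either the positions are in order, so the added indicator is weakly decreasing too, or the
      -- entries drop by at least `1`, which the indicator can at most level out.
      rcases (stableSort_lt_iff η b a).mp hab with h | h
      · have := Fin.lt_def.mp h.1
        split_ifs <;> omega
      · split_ifs <;> omega

end Compositions

namespace SuperPartition

variable {N : ℕ} (L : SuperPartition N)

theorem blockRev_val (i : Fin N) : (L.blockRev i).val =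
    if i.val < L.m 0 then L.m 0 - 1 - i
    else if i.val < L.m 0 + L.m 1 then L.m 0 + (L.m 0 + L.m 1 - 1 - i)
    else if i.val < L.m 0 + L.m 1 + L.m 2 then L.m 0 + L.m 1 + (L.m 0 + L.m 1 + L.m 2 - 1 - i)
    else L.m 0 + L.m 1 + L.m 2 + (N - 1 - i) := by
  simp only [blockRev, partialSum_zero, partialSum_one, partialSum_two]
  split_ifs <;> rfl

theorem blockRev_involutive : Function.Involutive L.blockRev := by
  intro i
  have hN := L.le_card
  rw [partialSum_two] at hN
  have hi := i.isLt
  apply Fin.ext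
  rw [blockRev_val, blockRev_val]
  split_ifs <;> omega

theorem blockRev_lt_iff (i : Fin N) (k : Fin 3) :
    (L.blockRev i).val < partialSum L.m k ↔ i.val < partialSum L.m k := by
  have h0 := partialSum_zero L.m
  have h1 := partialSum_one L.m
  have h2 := partialSum_two L.m
  have hN := L.le_card
  have hi := i.isLt
  rw [blockRev_val]
  fin_cases k <;> simp only [Fin.zero_eta, Fin.mk_one, Fin.reduceFinMk] <;> split_ifs <;> omega

theorem sortDesc_rev : sortDesc L.rev = L.bosonic :=
  sortDesc_comp_perm L.parts L.blockRev_involutive.toPerm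

theorem shifted_eq (k : Fin 3) (p : Fin N) :
    L.shifted k p
      = L.bosonic p + if (stableSort L.rev p).val < partialSum L.m k then 1 else 0 := by
  rw [← sortDesc_rev, ← sortDesc_add_indicator, shifted,
    ← sortDesc_comp_perm _ L.blockRev_involutive.toPerm]
  congr 1
  funext i
  simp [Function.comp_apply, rev, blockRev_lt_iff]

/-- By `shifted_eq`, row `p` grows exactly when its entry sits among the first `M_k` positions of
`Λ^R`, so sorting matches the two index sets. -/
theorem sum_etaHat_rev {F : Type*} [Field F] (α : F) (k : Fin 3) :
    ∑ i with (i : Fin N).val < partialSum L.m k, etaHat α L.rev i = charge α L k := by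
  rw [charge, Finset.sum_filter, Finset.sum_filter, ← Equiv.sum_comp (stableSort L.rev)]
  refine Finset.sum_congr rfl fun p _ => ?_
  rw [shifted_eq, etaHat_stableSort, sortDesc_rev]
  by_cases h : (stableSort L.rev p).val < partialSum L.m k
  · simp [h]
  · simp [h]

/-- Only the first square is reindexed by the sorting. Row `p` then gives a difference of squares,
`4 α λ_p (α λ_p + N - 1 - 2 p)` with `λ = Λ^[0]` and `p` counted from zero. -/
theorem sum_etaHat_rev_sq {F : Type*} [Field F] (α : F) :
    ∑ i : Fin N, ((2 * etaHat α L.rev i + ((N : F) - 1)) ^ 2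
      - ((N : F) - 1 - 2 * ((i : ℕ) : F)) ^ 2) = 4 * energy α L := by
  rw [Finset.sum_sub_distrib,
    ← Equiv.sum_comp (stableSort L.rev) fun i => (2 * etaHat α L.rev i + ((N : F) - 1)) ^ 2,
    ← Finset.sum_sub_distrib, energy, Finset.mul_sum]
  refine Finset.sum_congr rfl fun p _ => ?_
  rw [etaHat_stableSort, sortDesc_rev]
  ring

end SuperPartition

/-! ### Action on symmetric superpolynomials -/

section Super

variable {F : Type*} [Field F] {N : ℕ}

theorem superPerm_tmul (σ : Equiv.Perm (Fin N)) (f : MvPolynomial (Fin N) F) (g : Grassmann F N) :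
    superPerm F σ (f ⊗ₜ[F] g) = rename σ f ⊗ₜ[F] grassmannPerm F σ g := rfl

theorem superPerm_superPerm (σ τ : Equiv.Perm (Fin N)) (P : SuperPoly F N) :
    superPerm F σ (superPerm F τ P) = superPerm F (σ * τ) P := by
  induction P using TensorProduct.induction_on with
  | zero => simp
  | tmul f g => simp only [superPerm_tmul, rename_rename_perm, grassmannPerm_mul]; rfl
  | add x y hx hy => simp only [map_add, hx, hy]

/-- On superpolynomials invariant under the simultaneous exchange of the triples, the exchange of
the anticommuting variables equals that of the commuting ones. -/
theorem map_id_grassmannPerm_swap {i j : Fin N} {P : SuperPoly F N}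
    (hP : superPerm F (Equiv.swap i j) P = P) :
    TensorProduct.map LinearMap.id (grassmannPerm F (Equiv.swap i j)) P
      = TensorProduct.map (rename (R := F) (Equiv.swap i j)).toLinearMap LinearMap.id P := by
  -- With `P` replaced by `K_{ij} P` on the right, the commuting variables are exchanged twice and
  -- only the fermionic exchange survives.
  nth_rewrite 2 [← hP]
  rw [superPerm, ← LinearMap.comp_apply, ← TensorProduct.map_comp]
  congr 2
  refine LinearMap.ext fun f => ?_
  change f = rename _ (rename _ f)
  rw [rename_rename_perm, Equiv.swap_mul_self, Equiv.Perm.coe_one, rename_id_apply]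

theorem map_one_sub_kappa {i j : Fin N} (hij : i ≠ j) {P : SuperPoly F N}
    (hP : superPerm F (Equiv.swap i j) P = P)
    (A : MvPolynomial (Fin N) F →ₗ[F] FractionRing (MvPolynomial (Fin N) F)) :
    TensorProduct.map A (1 - kappaPhi F i j * kappaTheta F i j) P
      = TensorProduct.map (A ∘ₗ (LinearMap.id - (rename (R := F) (Equiv.swap i j)).toLinearMap))
        LinearMap.id P := by
  have h := congrArg (TensorProduct.map A LinearMap.id) (map_id_grassmannPerm_swap hP)
  rw [← LinearMap.comp_apply, ← LinearMap.comp_apply, ← TensorProduct.map_comp,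
    ← TensorProduct.map_comp, LinearMap.comp_id, LinearMap.comp_id, LinearMap.id_comp] at h
  have h1 : ∀ G : Module.End F (Grassmann F N), TensorProduct.map A (1 - G)
      = TensorProduct.map A LinearMap.id - TensorProduct.map A G := fun G =>
    TensorProduct.ext' fun f g => by
      simp [TensorProduct.tmul_sub]
  have h2 : ∀ B : MvPolynomial (Fin N) F →ₗ[F] FractionRing (MvPolynomial (Fin N) F),
      TensorProduct.map (A - B) (LinearMap.id : Module.End F (Grassmann F N))
      = TensorProduct.map A LinearMap.id - TensorProduct.map B LinearMap.id := fun B =>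
    TensorProduct.ext' fun f g => by
      simp [TensorProduct.sub_tmul]
  rw [kappaPhi_mul_kappaTheta F hij, LinearMap.comp_sub, LinearMap.comp_id, h1, h2,
    LinearMap.sub_apply, LinearMap.sub_apply, h]

/-- The Hamiltonian acts on symmetric superpolynomials through the commuting variables only. -/
theorem hamiltonian_eq_calogero [CharZero F] {α : F} (hα : α ≠ 0) {P : SuperPoly F N}
    (hP : ∀ σ, superPerm F σ P = P) :
    hamiltonian N α⁻¹ P = (4 * α ^ 2)⁻¹ •
      TensorProduct.map (polyToRat F N ∘ₗ calogero N α) LinearMap.id P := by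
  have h1 : (∑ i : Fin N, ∑ j ∈ Finset.Ioi i,
      TensorProduct.map
        (LinearMap.mulLeft F (ratVar F i * ratVar F j / (ratVar F i - ratVar F j) ^ 2)
          ∘ₗ polyToRat F N)
        (1 - kappaPhi F i j * kappaTheta F i j)) P
      = (∑ i : Fin N, ∑ j ∈ Finset.Ioi i,
      TensorProduct.map
        ((LinearMap.mulLeft F (ratVar F i * ratVar F j / (ratVar F i - ratVar F j) ^ 2)
          ∘ₗ polyToRat F N) ∘ₗ (LinearMap.id - (rename (R := F) (Equiv.swap i j)).toLinearMap))
        LinearMap.id) P := by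
    simp only [LinearMap.sum_apply]
    exact Finset.sum_congr rfl fun i _ => Finset.sum_congr rfl fun j hj =>
      map_one_sub_kappa (Finset.mem_Ioi.mp hj).ne (hP _) _
  rw [hamiltonian, LinearMap.sub_apply, LinearMap.smul_apply _ _ P, h1]
  rw [← LinearMap.smul_apply, ← LinearMap.smul_apply, ← LinearMap.sub_apply]
  congr 1
  -- Without the fermionic exchanges both operators act on the left factor only, so they agree on
  -- all pure tensors and symmetry is no longer needed.
  refine TensorProduct.ext' fun f g => ?_
  have h4 : (4 * α ^ 2 : F) ≠ 0 := mul_ne_zero (by norm_num) (pow_ne_zero 2 hα)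
  rw [LinearMap.smul_apply, TensorProduct.map_tmul, LinearMap.comp_apply, polyToRat_calogero hα,
    ← TensorProduct.smul_tmul', smul_smul, inv_mul_cancel₀ h4, one_smul]
  simp only [LinearMap.sub_apply, LinearMap.add_apply, LinearMap.smul_apply, LinearMap.sum_apply,
    TensorProduct.map_tmul, LinearMap.comp_apply, LinearMap.id_apply, LinearMap.mulLeft_apply,
    AlgHom.toLinearMap_apply, TensorProduct.sub_tmul, TensorProduct.add_tmul,
    TensorProduct.sum_tmul, ← TensorProduct.smul_tmul', ratCot]

/-- The non-symmetric Jack polynomial is a joint eigenfunction of the Dunkl operators; the fallback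
value `0` in its definition satisfies the equations as well. -/
theorem dunkl_nonsymJack (α : F) (η : Fin N → ℕ) (i : Fin N) :
    dunkl α i (nonsymJack α η) = etaHat α η i • nonsymJack α η := by
  classical
  unfold nonsymJack
  split_ifs with h
  · exact h.choose_spec.1.2.2 i
  · simp

/-- The symmetrization of a product of a polynomial and a fermionic monomial. -/
def symmetrization (m : Fin 3 → ℕ) (f : MvPolynomial (Fin N) F) : SuperPoly F N :=
  ∑ ω : Equiv.Perm (Fin N), superPerm F ω (f ⊗ₜ[F] fermionMonomial F N m)

theorem sum_superPerm_superPerm (σ : Equiv.Perm (Fin N)) (P : SuperPoly F N) :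
    ∑ ω : Equiv.Perm (Fin N), superPerm F ω (superPerm F σ P)
      = ∑ ω : Equiv.Perm (Fin N), superPerm F ω P := by
  simp only [superPerm_superPerm]
  exact Equiv.sum_comp (Equiv.mulRight σ) fun ω => superPerm F ω P

theorem superPerm_symmetrization (σ : Equiv.Perm (Fin N)) (m : Fin 3 → ℕ)
    (f : MvPolynomial (Fin N) F) :
    superPerm F σ (symmetrization m f) = symmetrization m f := by
  simp only [symmetrization, map_sum, superPerm_superPerm]
  exact Equiv.sum_comp (Equiv.mulLeft σ) fun ω => superPerm F ω (f ⊗ₜ[F] fermionMonomial F N m)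

theorem hamiltonian_symmetrization [CharZero F] {α : F} (hα : α ≠ 0) (m : Fin 3 → ℕ)
    {f : MvPolynomial (Fin N) F} {c : Fin N → F} (hf : ∀ i, dunkl α i f = c i • f) :
    hamiltonian N α⁻¹ (symmetrization m f)
      = ((4 * α ^ 2)⁻¹ * ∑ i : Fin N, ((2 * c i + ((N : F) - 1)) ^ 2
          - ((N : F) - 1 - 2 * ((i : ℕ) : F)) ^ 2))
        • superToRat F N (symmetrization m f) := by
  rw [hamiltonian_eq_calogero hα fun σ => superPerm_symmetrization σ m f, mul_smul]
  congr 1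
  simp only [symmetrization, map_sum, Finset.smul_sum, superPerm_tmul, superToRat,
    TensorProduct.map_tmul, LinearMap.comp_apply, ← rename_calogero,
    calogero_eq_of_dunkl_eq α c f hf, map_smul, TensorProduct.smul_tmul']

theorem conserved_symmetrization [CharZero F] {α : F} {m : Fin 3 → ℕ} (hm : partialSum m 2 ≤ N)
    {f : MvPolynomial (Fin N) F} {c : Fin N → F} (hf : ∀ i, dunkl α i f = c i • f) (k : Fin 3) :
    conserved N α k (symmetrization m f)
      = (∑ i with (i : Fin N).val < partialSum m k, c i) • symmetrization m f := by
  have hterm : ∀ (m' : Fin 3 → ℕ) (σ : Equiv.Perm (Fin N)),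
      TensorProduct.map LinearMap.id (fermionProj F N m')
        (TensorProduct.map (∑ i with (i : Fin N).val < partialSum m' k, dunkl α i) LinearMap.id
          (superPerm F σ (f ⊗ₜ[F] fermionMonomial F N m)))
      = if blockType N m' ∘ σ = blockType N m then
          (∑ i with (i : Fin N).val < partialSum m' k, dunkl α i) (rename σ f)
            ⊗ₜ[F] grassmannPerm F σ (fermionMonomial F N m)
        else 0 := by
    intro m' σ
    rw [superPerm_tmul, TensorProduct.map_tmul, TensorProduct.map_tmul, LinearMap.id_apply,
      LinearMap.id_apply, fermionProj_grassmannPerm]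
    split_ifs
    · rfl
    · rw [TensorProduct.tmul_zero]
  have hmem : m ∈ sectors N := by
    have h2 := partialSum_two m
    rw [sectors, Finset.mem_filter, Fintype.mem_piFinset]
    refine ⟨fun j => Finset.mem_range.mpr ?_, hm⟩
    fin_cases j <;> simp only [Fin.zero_eta, Fin.mk_one, Fin.reduceFinMk] <;> omega
  simp only [conserved, LinearMap.sum_apply, LinearMap.smul_apply, LinearMap.comp_apply]
  -- A sector other than that of the monomial contributes nothing: no permutation carries one block
  -- structure to the other.
  rw [Finset.sum_eq_single_of_mem m hmem]
  · have hinner : TensorProduct.map LinearMap.id (fermionProj F N m)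
        (TensorProduct.map (∑ i with (i : Fin N).val < partialSum m k, dunkl α i) LinearMap.id
          (symmetrization m f))
        = ∑ σ ∈ Finset.univ.filter fun σ : Equiv.Perm (Fin N) =>
            blockType N m ∘ σ = blockType N m,
          (∑ i with (i : Fin N).val < partialSum m k, c i)
            • superPerm F σ (f ⊗ₜ[F] fermionMonomial F N m) := by
      simp only [symmetrization, map_sum, hterm]
      refine Eq.trans (Finset.sum_congr rfl fun σ _ => ?_) (Finset.sum_filter _ _).symm
      split_ifs with h
      · rw [LinearMap.sum_apply, ← rename_sum_dunkl α _ σ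
          (fun i => lt_partialSum_iff_of_blockType (congrFun h i) k), superPerm_tmul,
          Finset.sum_congr rfl fun i _ => hf i, ← Finset.sum_smul, map_smul,
          TensorProduct.smul_tmul']
      · rfl
    have hY : (youngCard N m : F) ≠ 0 := by
      rw [Nat.cast_ne_zero, youngCard]; positivity
    simp only [hinner, map_sum, map_smul]
    rw [Finset.sum_comm]
    -- Each block-preserving `σ` is absorbed into the sum over `ω`, leaving the full symmetrization
    -- once for every element of the Young subgroup.
    simp only [← Finset.smul_sum, sum_superPerm_superPerm, Finset.sum_const, card_blockType hm]
    rw [← Nat.cast_smul_eq_nsmul F, smul_smul, smul_smul, mul_right_comm,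
      inv_mul_cancel₀ hY, one_mul]
    rfl
  · intro m' hm' hne
    have h0 : TensorProduct.map LinearMap.id (fermionProj F N m')
        (TensorProduct.map (∑ i with (i : Fin N).val < partialSum m' k, dunkl α i) LinearMap.id
          (symmetrization m f)) = 0 := by
      simp only [symmetrization, map_sum, hterm]
      refine Finset.sum_eq_zero fun σ _ => if_neg fun h => hne ?_
      exact (eq_of_blockType_comp_eq hm (Finset.mem_filter.mp hm').2 σ h).symm
    simp only [h0, map_zero, Finset.sum_const_zero, smul_zero]

theorem jackSuper_eq (α : F) (L : SuperPartition N) :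
    jackSuper α L = ((-1 : F) ^ ((L.m 1).choose 2 + (L.m 2).choose 2) / (L.norm : F))
      • symmetrization L.m (nonsymJack α L.rev) := rfl

end Super

end SuperCS

end

theorem mainTheorem10 {F : Type*} [Field F] [CharZero F] (α : F)
    (hα : ∀ a b : ℕ, 0 < a → (a : F) * α + (b : F) ≠ 0)
    (N : ℕ) (L : SuperCS.SuperPartition N) :
    SuperCS.hamiltonian N α⁻¹ (SuperCS.jackSuper α L)
        = (α⁻¹ ^ 2 * SuperCS.energy α L) • SuperCS.superToRat F N (SuperCS.jackSuper α L) ∧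
      ∀ k : Fin 3, SuperCS.conserved N α k (SuperCS.jackSuper α L)
        = SuperCS.charge α L k • SuperCS.jackSuper α L := by
  -- The instance `a = 1`, `b = 0` of the hypothesis.
  have hα0 : α ≠ 0 := by simpa using hα 1 0 one_pos
  have hE := SuperCS.dunkl_nonsymJack α L.rev
  refine ⟨?_, fun k => ?_⟩
  · rw [SuperCS.jackSuper_eq, map_smul, map_smul, SuperCS.hamiltonian_symmetrization hα0 L.m hE,
      L.sum_etaHat_rev_sq, smul_comm]
    congr 1
    field_simp
  · rw [SuperCS.jackSuper_eq, map_smul, SuperCS.conserved_symmetrization L.le_card hE,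
      L.sum_etaHat_rev, smul_comm]
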